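/- Let $Q$ be a finite-dimensional smooth manifold (Hausdorff, second countable, without boundary) with projections $\tau_Q:TQ\to Q$, $\pi_Q:T^*Q\to Q$, and let $L:TQ\to\mathbb R$ be a smooth function. Let $S=dq^A\otimes\partial/\partial v^A$ be the vertical endomorphism and $\Delta=v^A\,\partial/\partial v^A$ the Liouville vector field of $TQ$. Put $\theta_L=S^*(dL)$, $\Omega_L=-d\theta_L$, $E_L=\Delta(L)-L$, and let $FL:TQ\to T^*Q$, $FL(q,v)=(q,\partial L/\partial v)$, be the Legendre transformation. Assume that $L$ is almost regular: $M_1=FL(TQ)$ is an embedded submanifold of $T^*Q$ and $FL:TQ\to M_1$ is a surjective submersion with connected fibres. Let $W_0=TQ\oplus T^*Q$ be the Whitney sum, with projections $pr_1:W_0\to TQ$, $pr_2:W_0\to T^*Q$, $pr:W_0\to Q$. Let $\Omega=pr_2^*\Omega_Q$, where $\Omega_Q=-d\theta_Q$ is the canonical symplectic form of $T^*Q$ ($\theta_Q$ the Liouville form), and let $D(X_q,\alpha_q)=\alpha_q(X_q)-L(X_q)$. The constraint algorithm for $(W_0,\Omega,dD)$ gives, for $k\ge 0$, $$W_{k+1}=\{x\in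 W_k:\ \exists X\in T_xW_k\ \text{with}\ i_X\Omega=dD\ \text{on } T_xW_0\},$$ and the algorithm for $(TQ,\Omega_L,dE_L)$ gives $P_1=TQ$ and, for $k\ge1$, $$P_{k+1}=\{x\in P_k:\ \exists \xi\in T_xP_k\ \text{with}\ i_\xi\Omega_L=dE_L\ \text{on } T_x(TQ)\}.$$ Assume that all the $W_k$ and $P_k$ are embedded submanifolds. Then: (i) If $p\in W_1$ and $X\in T_pW_1$ satisfies $i_X\Omega=dD$ at $p$, then $X_1=T\,pr_1(X)\in T_{pr_1(p)}(TQ)$ satisfies $i_{X_1}\Omega_L=dE_L$ and the SODE condition $S X_1=\Delta$ at $pr_1(p)$. (ii) For every $k\ge1$, $pr_1(W_k)\subset P_k$. (iii) Suppose that both algorithms stabilize, $W_f=W_k=W_{k+1}$ for some $k\geq 0$ and $P_f=P_l=P_{l+1}$ for some $l\ge1$, and that there is a smooth vector field $\xi$ on $P_f$ (tangent to $P_f$) which solves $i_\xi\Omega_L=dE_L$ at all points of $P_f$. Then $pr(W_f)=\tau_Q(P_f)$. -/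

import Mathlib

open Set Bundle Topology
open scoped Manifold ContDiff

noncomputable section

namespace SkinnerRusk

/-! ### Calculus on manifolds: differentials, exterior derivatives, submanifolds -/

section General

variable {E : Type*} [NormedAddCommGroup E] [NormedSpace ℝ E]
  {H : Type*} [TopologicalSpace H] (I : ModelWithCorners ℝ E H)
  {M : Type*} [TopologicalSpace M] [ChartedSpace H M]

/-- The differential `df(x) : T_x M → ℝ` of a real function. -/
def dFun (f : M → ℝ) (x : M) : TangentSpace I x →L[ℝ] ℝ :=
  mfderiv I 𝓘(ℝ, ℝ) f x

/-- The expression of a 1-form `α` in the preferred chart `φ` at `x₀`: the pullback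
`(φ⁻¹)^* α`, a 1-form on the model vector space. -/
def chartForm (α : ∀ x : M, TangentSpace I x →L[ℝ] ℝ) (x₀ : M) (y : E) : E →L[ℝ] ℝ :=
  (α ((extChartAt I x₀).symm y)).comp (mfderiv 𝓘(ℝ, E) I (extChartAt I x₀).symm y)

/-- The exterior derivative of a 1-form `α` on a manifold without boundary, computed in the
preferred chart at the point, with the convention
`dα(X, Y) = X(α(Y)) - Y(α(X)) - α([X, Y])`. -/
def extD (α : ∀ x : M, TangentSpace I x →L[ℝ] ℝ) (x : M) (X Y : TangentSpace I x) : ℝ :=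
  let X' : E := mfderiv I 𝓘(ℝ, E) (extChartAt I x) x X
  let Y' : E := mfderiv I 𝓘(ℝ, E) (extChartAt I x) x Y
  fderiv ℝ (chartForm I α x) (extChartAt I x x) X' Y' -
    fderiv ℝ (chartForm I α x) (extChartAt I x x) Y' X'

/-- `S` is an embedded (smooth) submanifold of the manifold without boundary `M`: around each of
its points there is a smooth chart of `M` with values in the model vector space that straightens
`S` to a linear subspace. -/
def IsEmbeddedSubmanifold (S : Set M) : Prop :=
  ∀ x ∈ S, ∃ (φ : OpenPartialHomeomorph M E) (V : Submodule ℝ E),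
    x ∈ φ.source ∧ ContMDiffOn I 𝓘(ℝ, E) ∞ φ φ.source ∧
    ContMDiffOn 𝓘(ℝ, E) I ∞ φ.symm φ.target ∧
    φ '' (S ∩ φ.source) = (V : Set E) ∩ φ.target

/-- The tangent space `T_x S ⊆ T_x M` of a subset `S`: the velocities at `x` of the smooth curves
of `M` that run in `S`. -/
def tangentSet (S : Set M) (x : M) : Set (TangentSpace I x) :=
  {X | ∃ γ : ℝ → M, (∀ᶠ t in 𝓝 (0 : ℝ), ContMDiffAt 𝓘(ℝ, ℝ) I ∞ γ t ∧ γ t ∈ S) ∧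
    (⟨γ 0, mfderiv 𝓘(ℝ, ℝ) I γ 0 (1 : ℝ)⟩ : TotalSpace E (TangentSpace I : M → Type _)) = ⟨x, X⟩}

/-- The tangent vector `X ∈ T_x M` solves `i_X β = df` at `x`. -/
def Solves (β : ∀ x : M, TangentSpace I x → TangentSpace I x → ℝ) (f : M → ℝ)
    (x : M) (X : TangentSpace I x) : Prop :=
  ∀ Y : TangentSpace I x, β x X Y = dFun I f x Y

/-- The Gotay-Nester-Hinds constraint algorithm for the presymplectic system `(M, β, df)`, starting
from `M` itself at index `0`: the next set consists of the points of the present one at which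
`i_X β = df` has a solution `X` tangent to the present one. -/
def constraintSet (β : ∀ x : M, TangentSpace I x → TangentSpace I x → ℝ) (f : M → ℝ) :
    ℕ → Set M
  | 0 => univ
  | k + 1 => {x | x ∈ constraintSet β f k ∧
      ∃ X ∈ tangentSet I (constraintSet β f k) x, Solves I β f x X}

end General

variable (E : Type*) [NormedAddCommGroup E] [NormedSpace ℝ E]
  (Q : Type*) [TopologicalSpace Q] [ChartedSpace E Q]

/-! ### The bundles `TQ`, `T^*Q`, `TQ ⊕ T^*Q` -/

/-- The cotangent space `T_q^* Q`. -/
abbrev CotangentSpace (q : Q) : Type _ :=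
  TangentSpace 𝓘(ℝ, E) q →L[ℝ] Bundle.Trivial Q ℝ q

/-- The tangent bundle `TQ`. -/
abbrev TQ : Type _ := TangentBundle 𝓘(ℝ, E) Q

/-- The cotangent bundle `T^*Q`. -/
abbrev TStarQ : Type _ := TotalSpace (E →L[ℝ] ℝ) (CotangentSpace E Q)

/-- The Whitney sum `W₀ = TQ ⊕ T^*Q`. -/
abbrev Pontryagin : Type _ :=
  TotalSpace (E × (E →L[ℝ] ℝ))
    ((TangentSpace 𝓘(ℝ, E) : Q → Type _) ×ᵇ (CotangentSpace E Q))

/-- The model of `TQ`. -/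
abbrev IT : ModelWithCorners ℝ (E × E) (ModelProd E E) := 𝓘(ℝ, E).tangent

/-- The model of `T^*Q`. -/
abbrev ITStar : ModelWithCorners ℝ (E × (E →L[ℝ] ℝ)) (ModelProd E (E →L[ℝ] ℝ)) :=
  𝓘(ℝ, E).prod 𝓘(ℝ, E →L[ℝ] ℝ)

/-- The model of `TQ ⊕ T^*Q`. -/
abbrev IW : ModelWithCorners ℝ (E × (E × (E →L[ℝ] ℝ))) (ModelProd E (E × (E →L[ℝ] ℝ))) :=
  𝓘(ℝ, E).prod 𝓘(ℝ, E × (E →L[ℝ] ℝ))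

variable {E Q}

/-- `pr₁ : TQ ⊕ T^*Q → TQ`. -/
def pr₁ (w : Pontryagin E Q) : TQ E Q := ⟨w.proj, w.snd.1⟩

/-- `pr₂ : TQ ⊕ T^*Q → T^*Q`. -/
def pr₂ (w : Pontryagin E Q) : TStarQ E Q := ⟨w.proj, w.snd.2⟩

/-- `pr : TQ ⊕ T^*Q → Q`. -/
def pr (w : Pontryagin E Q) : Q := w.proj

/-- `τ_Q : TQ → Q`. -/
def tau (v : TQ E Q) : Q := v.proj

/-- `π_Q : T^*Q → Q`. -/
def piQ (a : TStarQ E Q) : Q := a.proj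

variable [IsManifold 𝓘(ℝ, E) ∞ Q]

/-! ### Canonical forms and the Skinner-Rusk system -/

/-- The Liouville 1-form of `T^*Q`, `θ_Q(α)(X) = α(Tπ_Q X)`; in coordinates `p_A dq^A`. -/
def thetaQ (a : TStarQ E Q) : TangentSpace (ITStar E) a →L[ℝ] ℝ :=
  ContinuousLinearMap.comp a.snd (mfderiv (ITStar E) 𝓘(ℝ, E) (piQ (E := E) (Q := Q)) a)

/-- The canonical symplectic form `Ω_Q = -dθ_Q`; in coordinates `dq^A ∧ dp_A`. -/
def OmegaQ (a : TStarQ E Q) (X Y : TangentSpace (ITStar E) a) : ℝ :=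
  - extD (ITStar E) (thetaQ (E := E) (Q := Q)) a X Y

/-- The 2-form `Ω = pr₂^* Ω_Q` on `TQ ⊕ T^*Q`. -/
def Omega (w : Pontryagin E Q) (X Y : TangentSpace (IW E) w) : ℝ :=
  OmegaQ (pr₂ w) (mfderiv (IW E) (ITStar E) pr₂ w X) (mfderiv (IW E) (ITStar E) pr₂ w Y)

/-- The generalized energy `D(X_q, α_q) = α_q(X_q) - L(X_q)`. -/
def energyD (L : TQ E Q → ℝ) (w : Pontryagin E Q) : ℝ := w.snd.2 w.snd.1 - L (pr₁ w)

/-! ### The Lagrangian system -/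

/-- The vertical lift `T_q Q → T_v(TQ)` at `v ∈ T_q Q`: the derivative of the inclusion of the
fibre `T_q Q` into `TQ`. -/
def vLift (v : TQ E Q) : TangentSpace 𝓘(ℝ, E) v.proj →L[ℝ] TangentSpace (IT E) v :=
  mfderiv 𝓘(ℝ, E) (IT E) (fun u : E => (⟨v.proj, u⟩ : TQ E Q)) v.snd

/-- The vertical endomorphism `S = dq^A ⊗ ∂/∂v^A`. -/
def vertS (v : TQ E Q) : TangentSpace (IT E) v →L[ℝ] TangentSpace (IT E) v :=
  (vLift v).comp (mfderiv (IT E) 𝓘(ℝ, E) (tau (E := E) (Q := Q)) v)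

/-- The Liouville vector field `Δ = v^A ∂/∂v^A`. -/
def liouville (v : TQ E Q) : TangentSpace (IT E) v := vLift v v.snd

/-- `θ_L = S^*(dL)`. -/
def thetaL (L : TQ E Q → ℝ) (v : TQ E Q) : TangentSpace (IT E) v →L[ℝ] ℝ :=
  (dFun (IT E) L v).comp (vertS v)

/-- The Poincaré-Cartan 2-form `Ω_L = -dθ_L`. -/
def OmegaL (L : TQ E Q → ℝ) (v : TQ E Q) (X Y : TangentSpace (IT E) v) : ℝ :=
  - extD (IT E) (thetaL L) v X Y

/-- The energy `E_L = Δ(L) - L`. -/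
def energyL (L : TQ E Q → ℝ) (v : TQ E Q) : ℝ := dFun (IT E) L v (liouville v) - L v

/-- The Legendre transformation `FL : TQ → T^*Q`, the fibre derivative of `L`;
in coordinates `(q, v) ↦ (q, ∂L/∂v)`. -/
def legendre (L : TQ E Q → ℝ) (v : TQ E Q) : TStarQ E Q :=
  ⟨v.proj, fderiv ℝ (fun u : E => L ⟨v.proj, u⟩) v.snd⟩

/-- `L` is almost regular: `M₁ = FL(TQ)` is a submanifold of `T^*Q`, and `FL : TQ → M₁` is a
(surjective) submersion with connected fibres. -/
structure AlmostRegular (L : TQ E Q → ℝ) : Prop where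
  submanifold : IsEmbeddedSubmanifold (ITStar E) (range (legendre L))
  submersion : ∀ v : TQ E Q, ∀ Y ∈ tangentSet (ITStar E) (range (legendre L)) (legendre L v),
    ∃ X : TangentSpace (IT E) v, mfderiv (IT E) (ITStar E) (legendre L) v X = Y
  connected_fibres : ∀ a ∈ range (legendre L), IsConnected (legendre L ⁻¹' {a})

/-! ### The two sequences of constraint submanifolds -/

/-- The constraint sets `W_k` of `(W₀ = TQ ⊕ T^*Q, Ω, dD)`. -/
def W (L : TQ E Q → ℝ) (k : ℕ) : Set (Pontryagin E Q) :=
  constraintSet (IW E) Omega (energyD L) k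

/-- The constraint sets `P_k`, `1 ≤ k`, of `(P₁ = TQ, Ω_L, dE_L)`: the numbering starts with
`P₁ = TQ` (the value at `k = 0` is not used). -/
def P (L : TQ E Q → ℝ) (k : ℕ) : Set (TQ E Q) :=
  constraintSet (IT E) (OmegaL L) (energyL L) (k - 1)

/-- `S ⊆ TQ` carries a smooth vector field `ξ`, tangent to `S`, with `i_ξ Ω_L = dE_L` at all points
of `S`. -/
def HasSolutionField (L : TQ E Q → ℝ) (S : Set (TQ E Q)) : Prop :=
  ∃ ξ : ∀ v : TQ E Q, TangentSpace (IT E) v,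
    ContMDiffOn (IT E) (IT E).tangent ∞
      (fun v => (⟨v, ξ v⟩ : TangentBundle (IT E) (TQ E Q))) S ∧
    ∀ v ∈ S, ξ v ∈ tangentSet (IT E) S v ∧ Solves (IT E) (OmegaL L) (energyL L) v (ξ v)

end SkinnerRusk

end

open SkinnerRusk

/-! In bundle coordinates `(q, v, p)` one has Ω = dq ∧ dp and dD = v dp + p dv - dL, so i_XΩ = dD
says X_q = v, p = ∂L/∂v and X_p = ∂L/∂q. The second condition does not involve X: it confines W₁ to
the graph of FL. A vector X tangent to W₁ therefore satisfies TFL(Tpr₁ X) = Tpr₂ X, and for such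
vectors on the graph the equation amounts to the Lagrangian equation for Tpr₁ X together with X_q =
v (`solves_W_iff_solves_L`). This is (i); induction gives (ii), since pr₁ carries curves in W_k to
curves in P_k.

In (iii), the inclusion ⊆ comes from (ii). For the converse, almost regularity gives smooth local
sections of FL (`exists_legendre_section`) and makes E_L constant on the fibres of FL
(`energyL_eq_of_legendre_eq`). Hence the Lagrangian equation for X at v depends only on FL(v) and
TFL(X), and every P_k is a union of fibres (`solves_of_mfderiv_legendre_eq`,
`constraintSet_saturated`).

The field ξ need not be second order, but if X solves the equation at v over q, then (q, X_q) lies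
in the FL-fibre of v (`legendre_mk_eq_of_solves`). To see this, let a be the point of that fibre
nearest to X_q. The solution transported to a keeps its base component, so X_q - a lies in ker TFL
and is tangent to the fibre; minimality forces a = X_q. Consequently, for a local section s, the map
σ = Tτ ∘ ξ ∘ s is again a section over FL(P_f). If a curve c in P_f has velocity ξ at s(p), then σ ∘
FL ∘ c has as velocity a second order solution at σ(p), so by induction the points (σ(p), p) survive
in every W_k (`exists_mem_W_of_solutionField`). -/

noncomputable section

namespace SkinnerRusk

/-! ### Derivatives and exterior derivatives read in the preferred chart. -/

section General

variable {E : Type*} [NormedAddCommGroup E] [NormedSpace ℝ E]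
  {H : Type*} [TopologicalSpace H] {I : ModelWithCorners ℝ E H} [I.Boundaryless]
  {M : Type*} [TopologicalSpace M] [ChartedSpace H M]
  {E' : Type*} [NormedAddCommGroup E'] [NormedSpace ℝ E']
  {H' : Type*} [TopologicalSpace H'] {I' : ModelWithCorners ℝ E' H'}
  {M' : Type*} [TopologicalSpace M'] [ChartedSpace H' M']

/-- On a manifold without boundary, the derivative of a map is the derivative of any local
representative in the preferred charts. -/
theorem hasMFDerivAt_of_eventuallyEq_chart {f : M → M'} {x : M} (hf : ContinuousAt f x)
    {F : E → E'} {F' : E →L[ℝ] E'}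
    (hF : ∀ᶠ y in 𝓝 (extChartAt I x x),
      extChartAt I' (f x) (f ((extChartAt I x).symm y)) = F y)
    (hF' : HasFDerivAt F F' (extChartAt I x x)) :
    HasMFDerivAt I I' f x F' := by
  refine ⟨hf, ?_⟩
  rw [I.range_eq_univ]
  exact (hF'.congr_of_eventuallyEq (f₁ := writtenInExtChartAt I I' x f) hF).hasFDerivWithinAt

theorem hasMFDerivAt_extChartAt_self (x : M) :
    HasMFDerivAt I 𝓘(ℝ, E) (extChartAt I x) x (ContinuousLinearMap.id ℝ E) := by
  refine hasMFDerivAt_of_eventuallyEq_chart (continuousAt_extChartAt x) (F := id) ?_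
    (hasFDerivAt_id _)
  filter_upwards [extChartAt_target_mem_nhds (I := I) x] with y hy
  exact (extChartAt I x).right_inv hy

/-- The preferred chart at `x` has derivative the identity at `x`, so only the antisymmetrized
derivative of the coefficients remains. -/
theorem extD_eq_of_chartForm {α : ∀ x : M, TangentSpace I x →L[ℝ] ℝ} {x : M}
    {β : E → E →L[ℝ] ℝ} {β' : E →L[ℝ] E →L[ℝ] ℝ}
    (h : ∀ᶠ y in 𝓝 (extChartAt I x x), chartForm I α x y = β y)
    (hβ : HasFDerivAt β β' (extChartAt I x x)) (X Y : E) :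
    extD I α x X Y = β' X Y - β' Y X := by
  have h1 : fderiv ℝ (chartForm I α x) (extChartAt I x x) = β' :=
    (hβ.congr_of_eventuallyEq h).fderiv
  unfold extD
  rw [h1, (hasMFDerivAt_extChartAt_self (I := I) x).mfderiv]
  rfl

end General

/-! ### Tangent vectors of subsets as velocities of curves. -/

section General

variable {E : Type*} [NormedAddCommGroup E] [NormedSpace ℝ E]
  {H : Type*} [TopologicalSpace H] {I : ModelWithCorners ℝ E H}
  {M : Type*} [TopologicalSpace M] [ChartedSpace H M]
  {E' : Type*} [NormedAddCommGroup E'] [NormedSpace ℝ E']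
  {H' : Type*} [TopologicalSpace H'] {I' : ModelWithCorners ℝ E' H'}
  {M' : Type*} [TopologicalSpace M'] [ChartedSpace H' M']

/-- A tangent vector of `S` at `x` is the velocity of a smooth curve in `S` through `x`. -/
theorem mem_tangentSet_iff {S : Set M} {x : M} {X : TangentSpace I x} :
    X ∈ tangentSet I S x ↔ ∃ γ : ℝ → M,
      (∀ᶠ t in 𝓝 (0 : ℝ), ContMDiffAt 𝓘(ℝ, ℝ) I ∞ γ t ∧ γ t ∈ S) ∧ γ 0 = x ∧
        (mfderiv 𝓘(ℝ, ℝ) I γ 0 (1 : ℝ) : E) = X := by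
  constructor
  · rintro ⟨γ, h, h'⟩
    exact ⟨γ, h, congrArg TotalSpace.proj h', congrArg (fun p : TotalSpace E
      (TangentSpace I : M → Type _) => (p.snd : E)) h'⟩
  · rintro ⟨γ, h, h0, h1⟩
    subst h0
    exact ⟨γ, h, congrArg (TotalSpace.mk (γ 0)) h1⟩

theorem mfderiv_comp_curve {f : M → M'} {γ : ℝ → M} {x : M} {X : TangentSpace I x}
    (hγ : MDifferentiableAt 𝓘(ℝ, ℝ) I γ 0) (h0 : γ 0 = x)
    (h1 : (mfderiv 𝓘(ℝ, ℝ) I γ 0 (1 : ℝ) : E) = X) (hf : MDifferentiableAt I I' f x) :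
    (mfderiv 𝓘(ℝ, ℝ) I' (f ∘ γ) 0 (1 : ℝ) : E') = mfderiv I I' f x X := by
  subst h0 h1
  rw [mfderiv_comp 0 hf hγ]
  rfl

theorem mfderiv_mem_tangentSet {f : M → M'} {S : Set M} {S' : Set M'} {x : M}
    {X : TangentSpace I x} (hX : X ∈ tangentSet I S x)
    (hf : ∀ᶠ z in 𝓝 x, ContMDiffAt I I' ∞ f z) (hS : ∀ᶠ z in 𝓝 x, z ∈ S → f z ∈ S') :
    mfderiv I I' f x X ∈ tangentSet I' S' (f x) := by
  obtain ⟨γ, hγ, h0, h1⟩ := mem_tangentSet_iff.1 hX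
  have hγ0 := hγ.self_of_nhds.1
  have hc : Filter.Tendsto γ (𝓝 0) (𝓝 x) := h0 ▸ hγ0.continuousAt
  refine mem_tangentSet_iff.2 ⟨f ∘ γ, ?_, congrArg f h0, mfderiv_comp_curve
    (hγ0.mdifferentiableAt (by simp)) h0 h1 (hf.self_of_nhds.mdifferentiableAt (by simp))⟩
  filter_upwards [hγ, hc.eventually hf, hc.eventually hS] with t ht hft hSt
  exact ⟨hft.comp t ht.1, hSt ht.2⟩

/-- Smooth maps that agree on `S` have the same derivatives along `S`. -/
theorem mfderiv_eq_of_eqOn {f g : M → M'} {S : Set M} {x : M}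
    {X : TangentSpace I x} (hX : X ∈ tangentSet I S x)
    (hf : MDifferentiableAt I I' f x) (hg : MDifferentiableAt I I' g x)
    (hS : ∀ᶠ z in 𝓝 x, z ∈ S → f z = g z) :
    (mfderiv I I' f x X : E') = mfderiv I I' g x X := by
  obtain ⟨γ, hγ, h0, h1⟩ := mem_tangentSet_iff.1 hX
  have hγ0 := hγ.self_of_nhds.1
  have hc : Filter.Tendsto γ (𝓝 0) (𝓝 x) := h0 ▸ hγ0.continuousAt
  have hγd := hγ0.mdifferentiableAt (by simp : (∞ : ℕ∞ω) ≠ 0)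
  rw [← mfderiv_comp_curve hγd h0 h1 hf, ← mfderiv_comp_curve hγd h0 h1 hg]
  have h : f ∘ γ =ᶠ[𝓝 0] g ∘ γ := by
    filter_upwards [hγ, hc.eventually hS] with t ht hSt
    exact hSt ht.2
  exact congrArg (fun A : ℝ →L[ℝ] E' => A 1) h.mfderiv_eq

end General

/-! ### Formal properties of the constraint algorithm. -/

section ConstraintSets

variable {F H M : Type*} [NormedAddCommGroup F] [NormedSpace ℝ F] [TopologicalSpace H]
  {I : ModelWithCorners ℝ F H} [TopologicalSpace M] [ChartedSpace H M]
  {β : ∀ x : M, TangentSpace I x → TangentSpace I x → ℝ} {f : M → ℝ}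

theorem constraintSet_antitone : Antitone (constraintSet I β f) :=
  antitone_nat_of_succ_le fun _ _ hx => hx.1

/-- Each step of the algorithm is determined by the current set alone, so one repetition stops it
for good. -/
theorem constraintSet_eq_of_stable {k : ℕ} (h : constraintSet I β f k = constraintSet I β f (k + 1))
    {m : ℕ} (hm : k ≤ m) : constraintSet I β f m = constraintSet I β f k := by
  induction m, hm using Nat.le_induction with
  | base => rfl
  | succ n _ ih =>
    rw [h, constraintSet, constraintSet, ih]

theorem tangentSet_mono {S T : Set M} (h : S ⊆ T) (x : M) : tangentSet I S x ⊆ tangentSet I T x :=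
  fun _ ⟨γ, hγ, h'⟩ => ⟨γ, hγ.mono fun _ ht => ⟨ht.1, h ht.2⟩, h'⟩

/-- If `f ∘ r = f` near `x`, then `f` has the same derivative on a vector and on its image under
`r`. -/
theorem mfderiv_apply_of_comp_eventuallyEq {F' H' M' : Type*} [NormedAddCommGroup F']
    [NormedSpace ℝ F'] [TopologicalSpace H'] {J : ModelWithCorners ℝ F' H'} [TopologicalSpace M']
    [ChartedSpace H' M'] {f : M → M'} {r : M → M} {x x' : M} (hr : MDifferentiableAt I I r x)
    (h0 : r x = x') (hf : MDifferentiableAt I J f x') (h : ∀ᶠ z in 𝓝 x, f (r z) = f z)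
    (Y : TangentSpace I x) :
    (mfderiv I J f x' (mfderiv I I r x Y : F) : F') = mfderiv I J f x Y := by
  subst h0
  have h1 := mfderiv_comp x hf hr
  have h2 : f ∘ r =ᶠ[𝓝 x] f := h
  have h3 := congrArg (fun A : F →L[ℝ] F' => A Y) (h1.symm.trans h2.mfderiv_eq)
  exact h3

end ConstraintSets

/-! ### Submersions onto a linear subspace of a finite-dimensional space. -/

section Submersion

variable {X Y : Type*} [NormedAddCommGroup X] [NormedSpace ℝ X]
  [NormedAddCommGroup Y] [NormedSpace ℝ Y] [FiniteDimensional ℝ Y]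

/-- Difference quotients stay in `V`, which is closed because it is finite-dimensional. -/
theorem fderiv_mem_submodule {G : X → Y} {U : Set X} (hU : IsOpen U) {V : Submodule ℝ Y}
    (hV : ∀ x ∈ U, G x ∈ V) {x : X} (hx : x ∈ U) (w : X) : fderiv ℝ G x w ∈ V := by
  by_cases hd : DifferentiableAt ℝ G x
  · have h1 : HasDerivAt (fun t : ℝ => G (x + t • w)) (fderiv ℝ G x w) 0 := by
      have h2 : HasDerivAt (fun t : ℝ => x + t • w) w 0 := by
        simpa using ((hasDerivAt_id (0 : ℝ)).smul_const w).const_add x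
      have h3 : HasFDerivAt G (fderiv ℝ G x) (x + (0 : ℝ) • w) := by
        simpa using hd.hasFDerivAt
      exact h3.comp_hasDerivAt 0 h2
    have h4 := h1.tendsto_slope
    refine V.closed_of_finiteDimensional.mem_of_tendsto h4 ?_
    have h5 : ∀ᶠ t in 𝓝 (0 : ℝ), x + t • w ∈ U := by
      have : ContinuousAt (fun t : ℝ => x + t • w) 0 := by fun_prop
      exact this.eventually (by simpa using hU.mem_nhds hx)
    filter_upwards [h5.filter_mono nhdsWithin_le_nhds] with t ht
    rw [slope_def_module]
    exact V.smul_mem _ (V.sub_mem (hV _ ht) (hV _ (by simpa using hx)))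
  · rw [fderiv_zero_of_not_differentiableAt hd]
    exact V.zero_mem

variable [FiniteDimensional ℝ X]

/-- Straightening of a submersion onto a linear subspace `V`. -/
theorem exists_straightening {G : X → Y} {U : Set X} (hU : IsOpen U) {x₀ : X} (hx₀ : x₀ ∈ U)
    (hG : ContDiffOn ℝ ∞ G U) {V : Submodule ℝ Y} (hV : ∀ x ∈ U, G x ∈ V)
    (hsurj : ∀ y ∈ V, ∃ x, fderiv ℝ G x₀ x = y) :
    ∃ (ρ : X →L[ℝ] (fderiv ℝ G x₀).ker)
      (e : OpenPartialHomeomorph X (V × (fderiv ℝ G x₀).ker)),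
      x₀ ∈ e.source ∧ e.source ⊆ U ∧ ContDiffOn ℝ ∞ e.symm e.target ∧
      (∀ x ∈ e.source, ((e x).1 : Y) = G x ∧ (e x).2 = ρ x) ∧
      ∀ k : (fderiv ℝ G x₀).ker, ρ k = k := by
  obtain ⟨P, hP⟩ := Submodule.ClosedComplemented.of_finiteDimensional V
  obtain ⟨ρ, hρ⟩ := Submodule.ClosedComplemented.of_finiteDimensional (fderiv ℝ G x₀).ker
  have hGd : ∀ x ∈ U, HasFDerivAt G (fderiv ℝ G x) x := fun x hx =>
    ((hG.contDiffAt (hU.mem_nhds hx)).differentiableAt (by simp)).hasFDerivAt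
  let Φ : X → V × (fderiv ℝ G x₀).ker := fun x => (P (G x), ρ x)
  have hΦ : ContDiffOn ℝ ∞ Φ U := (P.contDiff.comp_contDiffOn hG).prodMk ρ.contDiff.contDiffOn
  have hΦd : ∀ x ∈ U, HasFDerivAt Φ ((P.comp (fderiv ℝ G x)).prod ρ) x := fun x hx =>
    (P.hasFDerivAt.comp x (hGd x hx)).prodMk ρ.hasFDerivAt
  have hbij : Function.Bijective ((P.comp (fderiv ℝ G x₀)).prod ρ) := by
    constructor
    -- The derivative of `G` takes values in `V`, where `P` is the identity; so `w` lies in the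
    -- kernel, where `ρ` is the identity.
    · refine (injective_iff_map_eq_zero _).2 fun w hw => ?_
      obtain ⟨h1, h2⟩ := Prod.mk.inj hw
      have h3 : P (fderiv ℝ G x₀ w) = ⟨fderiv ℝ G x₀ w, fderiv_mem_submodule hU hV hx₀ w⟩ :=
        hP ⟨_, fderiv_mem_submodule hU hV hx₀ w⟩
      have h4 : fderiv ℝ G x₀ w = 0 := congrArg Subtype.val (h3.symm.trans h1)
      have h5 := hρ ⟨w, h4⟩
      exact congrArg Subtype.val (h5.symm.trans h2)
    · rintro ⟨y, k⟩
      obtain ⟨x, hx⟩ := hsurj y y.2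
      -- A preimage of `y` is corrected by a kernel vector, which adjusts the second component
      -- without moving the first.
      refine ⟨x + (k - ρ x : (fderiv ℝ G x₀).ker), Prod.ext ?_ ?_⟩
      · have h1 : fderiv ℝ G x₀ ((k - ρ x : (fderiv ℝ G x₀).ker) : X) = 0 := (k - ρ x).2
        change P (fderiv ℝ G x₀ _) = y
        rw [map_add, h1, hx, add_zero, hP]
      · change ρ _ = k
        rw [map_add, hρ]
        abel
  let Φ' : X ≃L[ℝ] V × (fderiv ℝ G x₀).ker :=
    (LinearEquiv.ofBijective ((P.comp (fderiv ℝ G x₀)).prod ρ).toLinearMap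
      hbij).toContinuousLinearEquiv
  have hΦ'd : HasFDerivAt Φ (Φ' : X →L[ℝ] V × (fderiv ℝ G x₀).ker) x₀ := hΦd x₀ hx₀
  have hΦat : ContDiffAt ℝ ∞ Φ x₀ := hΦ.contDiffAt (hU.mem_nhds hx₀)
  let e₀ := hΦat.toOpenPartialHomeomorph Φ hΦ'd (by simp)
  -- The inverse function theorem at `x₀` alone gives smoothness of the inverse at one point; on `O`
  -- the derivative of `Φ` is invertible everywhere, so the inverse is smooth on the whole target.
  let O : Set X := U ∩ fderiv ℝ Φ ⁻¹' range ((↑) : (X ≃L[ℝ] V × (fderiv ℝ G x₀).ker) → _)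
  have hO : IsOpen O := (hΦ.continuousOn_fderiv_of_isOpen hU (by simp)).isOpen_inter_preimage hU
    ContinuousLinearEquiv.isOpen
  refine ⟨ρ, e₀.restrOpen O hO, ?_, ?_, ?_, ?_, hρ⟩
  · refine ⟨hΦat.mem_toOpenPartialHomeomorph_source hΦ'd (by simp), hx₀, Φ', hΦ'd.fderiv.symm⟩
  · exact fun x hx => hx.2.1
  · intro z hz
    have hz' := (e₀.restrOpen O hO).map_target hz
    obtain ⟨h1, h2, A, hA⟩ := hz'
    refine ((e₀.restrOpen O hO).contDiffAt_symm (f₀' := A) hz ?_ ?_).contDiffWithinAt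
    · rw [hA]
      exact (hΦd _ h2).differentiableAt.hasFDerivAt
    · exact hΦ.contDiffAt (hU.mem_nhds h2)
  · intro x hx
    exact ⟨congrArg Subtype.val (hP ⟨G x, hV x hx.2.1⟩), rfl⟩

variable {G : X → Y} {U : Set X} {x₀ : X} {V : Submodule ℝ Y}

/-- The kernel coordinate of the straightening is frozen at `ρ x₀`. Projecting to `V` first makes
`s` smooth on an open set of `Y`, although it is a section only over `V`. -/
theorem exists_local_section (hU : IsOpen U) (hx₀ : x₀ ∈ U)
    (hG : ContDiffOn ℝ ∞ G U) (hV : ∀ x ∈ U, G x ∈ V)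
    (hsurj : ∀ y ∈ V, ∃ x, fderiv ℝ G x₀ x = y) :
    ∃ (s : Y → X) (N : Set Y), IsOpen N ∧ G x₀ ∈ N ∧ ContDiffOn ℝ ∞ s N ∧ s (G x₀) = x₀ ∧
      (∀ y ∈ N, s y ∈ U) ∧ ∀ y ∈ N, y ∈ V → G (s y) = y := by
  obtain ⟨ρ, e, h0, hs, hsm, he, hρ⟩ := exists_straightening hU hx₀ hG hV hsurj
  obtain ⟨P, hP⟩ := Submodule.ClosedComplemented.of_finiteDimensional V
  let j : Y → V × (fderiv ℝ G x₀).ker := fun y => (P y, ρ x₀)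
  have hj : ContDiff ℝ ∞ j := P.contDiff.prodMk contDiff_const
  have hj0 : j (G x₀) = e x₀ := by
    refine Prod.ext ?_ (he x₀ h0).2.symm
    exact (hP ⟨G x₀, hV x₀ hx₀⟩).trans (Subtype.ext (he x₀ h0).1.symm)
  refine ⟨e.symm ∘ j, j ⁻¹' e.target, e.open_target.preimage hj.continuous, ?_,
    hsm.comp hj.contDiffOn (fun y hy => hy), ?_, fun y hy => hs (e.map_target hy), ?_⟩
  · rw [mem_preimage, hj0]
    exact e.map_source h0
  · simp only [Function.comp, hj0]
    exact e.left_inv h0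
  · intro y hy hyV
    have h1 := (he _ (e.map_target hy)).1
    rw [e.right_inv hy] at h1
    exact h1.symm.trans (congrArg Subtype.val (hP ⟨y, hyV⟩))

/-- In the straightening the fibre is a slice with constant `V`-coordinate, and the curve is a line
in it. Its velocity lies in the kernel and has the same image under `ρ` as `w`, hence equals `w`. -/
theorem exists_fibre_curve (hU : IsOpen U) (hx₀ : x₀ ∈ U)
    (hG : ContDiffOn ℝ ∞ G U) (hV : ∀ x ∈ U, G x ∈ V)
    (hsurj : ∀ y ∈ V, ∃ x, fderiv ℝ G x₀ x = y) {w : X} (hw : fderiv ℝ G x₀ w = 0) :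
    ∃ c : ℝ → X, c 0 = x₀ ∧ HasDerivAt c w 0 ∧ ∀ᶠ t in 𝓝 (0 : ℝ), c t ∈ U ∧ G (c t) = G x₀ := by
  obtain ⟨ρ, e, h0, hs, hsm, he, hρ⟩ := exists_straightening hU hx₀ hG hV hsurj
  let j : ℝ → V × (fderiv ℝ G x₀).ker := fun t => ((e x₀).1, ρ x₀ + t • ρ w)
  have hj0 : j 0 = e x₀ := Prod.ext rfl (by simp [j, (he x₀ h0).2])
  have hjd : HasDerivAt j (0, ρ w) 0 := by
    refine (hasDerivAt_const _ _).prodMk ?_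
    simpa using ((hasDerivAt_id (0 : ℝ)).smul_const (ρ w)).const_add (ρ x₀)
  have hsd : DifferentiableAt ℝ e.symm (j 0) := by
    rw [hj0]
    exact (hsm.contDiffAt (e.open_target.mem_nhds (e.map_source h0))).differentiableAt (by simp)
  have hcd := hsd.hasFDerivAt.comp_hasDerivAt 0 hjd
  set z := fderiv ℝ e.symm (j 0) (0, ρ w) with hz
  have hc0 : (e.symm ∘ j) 0 = x₀ := by
    simp only [Function.comp, hj0]
    exact e.left_inv h0
  have hev : ∀ᶠ t in 𝓝 (0 : ℝ), j t ∈ e.target :=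
    hjd.continuousAt.eventually (by rw [hj0]; exact e.open_target.mem_nhds (e.map_source h0))
  have hGc : ∀ᶠ t in 𝓝 (0 : ℝ), G ((e.symm ∘ j) t) = G x₀ := by
    filter_upwards [hev] with t ht
    have h1 := (he _ (e.map_target ht)).1
    rw [e.right_inv ht] at h1
    exact h1.symm.trans (he x₀ h0).1
  have hρc : ∀ᶠ t in 𝓝 (0 : ℝ), ρ ((e.symm ∘ j) t) = ρ x₀ + t • ρ w := by
    filter_upwards [hev] with t ht
    have h1 := (he _ (e.map_target ht)).2
    rw [e.right_inv ht] at h1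
    exact h1.symm
  have hzG : fderiv ℝ G x₀ z = 0 := by
    have h1 : HasFDerivAt G (fderiv ℝ G x₀) ((e.symm ∘ j) 0) := by
      rw [hc0]
      exact ((hG.contDiffAt (hU.mem_nhds hx₀)).differentiableAt (by simp)).hasFDerivAt
    exact (h1.comp_hasDerivAt 0 hcd).unique ((hasDerivAt_const 0 (G x₀)).congr_of_eventuallyEq hGc)
  have hzρ : ρ z = ρ w := by
    have h1 : HasDerivAt (fun t : ℝ => ρ x₀ + t • ρ w) (ρ w) 0 := by
      simpa using ((hasDerivAt_id (0 : ℝ)).smul_const (ρ w)).const_add (ρ x₀)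
    exact (ρ.hasFDerivAt.comp_hasDerivAt 0 hcd).unique (h1.congr_of_eventuallyEq hρc)
  have hzw : z = w := by
    have h1 := hρ ⟨z, hzG⟩
    have h2 := hρ ⟨w, hw⟩
    exact congrArg Subtype.val ((h1.symm.trans hzρ).trans h2)
  refine ⟨e.symm ∘ j, hc0, hzw ▸ hcd, ?_⟩
  filter_upwards [hev, hGc] with t ht ht'
  exact ⟨hs (e.map_target ht), ht'⟩

/-- Along a slice with constant `V`-coordinate `G` is constant, so velocities there lie in the
kernel of its derivative and are killed by the derivative of `f`. A ball of the slice is connected.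
-/
theorem eventually_eq_of_fderiv_eq_zero_on_ker (hU : IsOpen U) (hx₀ : x₀ ∈ U)
    (hG : ContDiffOn ℝ ∞ G U) (hV : ∀ x ∈ U, G x ∈ V)
    (hsurj : ∀ y ∈ V, ∃ x, fderiv ℝ G x₀ x = y) {f : X → ℝ} (hf : DifferentiableOn ℝ f U)
    (hker : ∀ x ∈ U, ∀ w, fderiv ℝ G x w = 0 → fderiv ℝ f x w = 0) :
    ∀ᶠ x in 𝓝 x₀, G x = G x₀ → f x = f x₀ := by
  obtain ⟨ρ, e, h0, hs, hsm, he, hρ⟩ := exists_straightening hU hx₀ hG hV hsurj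
  obtain ⟨ε, hε, hball⟩ := Metric.isOpen_iff.1 e.open_target _ (e.map_source h0)
  have hmem : ∀ k ∈ Metric.ball (e x₀).2 ε, ((e x₀).1, k) ∈ e.target := fun k hk =>
    hball (by
      rw [← ball_prod_same]
      exact ⟨Metric.mem_ball_self hε, hk⟩)
  have hd : ∀ k ∈ Metric.ball (e x₀).2 ε,
      HasFDerivAt (fun k => f (e.symm ((e x₀).1, k))) (0 : (fderiv ℝ G x₀).ker →L[ℝ] ℝ) k := by
    intro k hk
    have hx := hs (e.map_target (hmem k hk))
    have h1 : HasFDerivAt (fun k => e.symm ((e x₀).1, k)) _ k := HasFDerivAt.comp k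
      ((hsm.contDiffAt (e.open_target.mem_nhds (hmem k hk))).differentiableAt
        (by simp)).hasFDerivAt (hasFDerivAt_prodMk_right (e x₀).1 k)
    have h2 := (hf.differentiableAt (hU.mem_nhds hx)).hasFDerivAt.comp k h1
    have h3 := ((hG.contDiffAt (hU.mem_nhds hx)).differentiableAt
      (by simp)).hasFDerivAt.comp k h1
    have h4 : HasFDerivAt (G ∘ fun k => e.symm ((e x₀).1, k))
        (0 : (fderiv ℝ G x₀).ker →L[ℝ] Y) k := by
      refine (hasFDerivAt_const (𝕜 := ℝ) (G x₀) k).congr_of_eventuallyEq ?_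
      filter_upwards [Metric.isOpen_ball.mem_nhds hk] with k' hk'
      have h1 := (he _ (e.map_target (hmem k' hk'))).1
      rw [e.right_inv (hmem k' hk')] at h1
      exact h1.symm.trans (he x₀ h0).1
    have h5 := h3.unique h4
    refine h2.congr_fderiv (ContinuousLinearMap.ext fun κ => ?_)
    exact hker _ hx _ (congrArg (fun A : (fderiv ℝ G x₀).ker →L[ℝ] Y => A κ) h5)
  have hev : ∀ᶠ x in 𝓝 x₀, x ∈ e.source ∧ e x ∈ Metric.ball (e x₀) ε :=
    Filter.Eventually.and (e.open_source.mem_nhds h0) ((e.continuousAt h0).eventually (Metric.ball_mem_nhds _ hε))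
  filter_upwards [hev] with x hx hGx
  rw [← ball_prod_same] at hx
  have h1 : e x = ((e x₀).1, (e x).2) :=
    Prod.ext (Subtype.ext (((he x hx.1).1.trans hGx).trans (he x₀ h0).1.symm)) rfl
  have h2 := Metric.isOpen_ball.is_const_of_fderiv_eq_zero (𝕜 := ℝ)
    (convex_ball (e x₀).2 ε).isPreconnected
    (fun k hk => (hd k hk).differentiableAt.differentiableWithinAt)
    (fun k hk => (hd k hk).fderiv) hx.2.2 (Metric.mem_ball_self hε)
  rw [← h1] at h2
  simp only [Prod.mk.eta, e.left_inv hx.1, e.left_inv h0] at h2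
  exact h2

end Submersion

/-! ### Explicit bundle charts of `TQ`, `T^*Q` and their Whitney sum. -/

variable {E : Type*} [NormedAddCommGroup E] [NormedSpace ℝ E]
  {Q : Type*} [TopologicalSpace Q] [ChartedSpace E Q] [IsManifold 𝓘(ℝ, E) ∞ Q]

/-- The fibre coordinate change of `TQ` from the chart at `q₀` to the point with coordinate `x`. -/
def frame (q₀ : Q) (x : E) : E →L[ℝ] E :=
  (trivializationAt E (TangentSpace 𝓘(ℝ, E)) q₀).symmL ℝ ((extChartAt 𝓘(ℝ, E) q₀).symm x)

/-- The inverse of `frame`. -/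
def coframe (q₀ : Q) (x : E) : E →L[ℝ] E :=
  (trivializationAt E (TangentSpace 𝓘(ℝ, E)) q₀).continuousLinearMapAt ℝ
    ((extChartAt 𝓘(ℝ, E) q₀).symm x)

theorem symm_mem_baseSet {q₀ : Q} {x : E} (hx : x ∈ (extChartAt 𝓘(ℝ, E) q₀).target) :
    (extChartAt 𝓘(ℝ, E) q₀).symm x ∈
      (trivializationAt E (TangentSpace 𝓘(ℝ, E)) q₀).baseSet := by
  rw [TangentBundle.trivializationAt_baseSet, ← extChartAt_source 𝓘(ℝ, E)]
  exact (extChartAt 𝓘(ℝ, E) q₀).map_target hx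

theorem coframe_frame {q₀ : Q} {x : E} (hx : x ∈ (extChartAt 𝓘(ℝ, E) q₀).target) (u : E) :
    coframe q₀ x (frame q₀ x u) = u :=
  (trivializationAt E (TangentSpace 𝓘(ℝ, E)) q₀).continuousLinearMapAt_symmL
    (symm_mem_baseSet hx) u

theorem frame_coframe {q₀ : Q} {x : E} (hx : x ∈ (extChartAt 𝓘(ℝ, E) q₀).target) (u : E) :
    frame q₀ x (coframe q₀ x u) = u :=
  (trivializationAt E (TangentSpace 𝓘(ℝ, E)) q₀).symmL_continuousLinearMapAt
    (symm_mem_baseSet hx) u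

theorem mfderiv_extChartAt_symm {q₀ : Q} {x : E} (hx : x ∈ (extChartAt 𝓘(ℝ, E) q₀).target) :
    mfderiv 𝓘(ℝ, E) 𝓘(ℝ, E) (extChartAt 𝓘(ℝ, E) q₀).symm x = frame q₀ x := by
  have h := TangentBundle.symmL_trivializationAt (I := 𝓘(ℝ, E)) (x₀ := q₀)
    (x := (extChartAt 𝓘(ℝ, E) q₀).symm x)
    (by rw [← extChartAt_source 𝓘(ℝ, E)]; exact (extChartAt 𝓘(ℝ, E) q₀).map_target hx)
  rw [(extChartAt 𝓘(ℝ, E) q₀).right_inv hx] at h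
  simp only [modelWithCornersSelf_coe, range_id, mfderivWithin_univ] at h
  exact h.symm

/-- This is why, at the centre of a bundle chart, the fibre coordinates of a point are its own
vector and covector without correction. -/
theorem frame_self (q₀ : Q) : frame q₀ (extChartAt 𝓘(ℝ, E) q₀ q₀) = ContinuousLinearMap.id ℝ E := by
  ext u
  have h := TangentBundle.symmL_trivializationAt_eq_core (I := 𝓘(ℝ, E)) (b₀ := q₀) (b := q₀)
    (mem_chart_source _ _)
  unfold frame
  rw [extChartAt_to_inv, h]
  exact (tangentBundleCore 𝓘(ℝ, E) Q).coordChange_self _ _ (mem_chart_source _ _) u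

theorem coframe_self (q₀ : Q) :
    coframe q₀ (extChartAt 𝓘(ℝ, E) q₀ q₀) = ContinuousLinearMap.id ℝ E := by
  ext u
  have h := coframe_frame (mem_extChartAt_target (I := 𝓘(ℝ, E)) q₀) u
  rwa [frame_self] at h

/-- The inverse of the chart of `TQ` over the chart at `q₀`. -/
def invT (q₀ : Q) (y : E × E) : TQ E Q :=
  ⟨(extChartAt 𝓘(ℝ, E) q₀).symm y.1, frame q₀ y.1 y.2⟩

/-- The inverse of the chart of `T^*Q` over the chart at `q₀`. -/
def invTStar (q₀ : Q) (y : E × (E →L[ℝ] ℝ)) : TStarQ E Q :=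
  ⟨(extChartAt 𝓘(ℝ, E) q₀).symm y.1, ((y.2.comp (coframe q₀ y.1) : E →L[ℝ] ℝ) : E →L[ℝ] ℝ)⟩

/-- The inverse of the chart of `TQ ⊕ T^*Q` over the chart at `q₀`. -/
def invW (q₀ : Q) (y : E × (E × (E →L[ℝ] ℝ))) : Pontryagin E Q :=
  ⟨(extChartAt 𝓘(ℝ, E) q₀).symm y.1, (frame q₀ y.1 y.2.1, (y.2.2.comp (coframe q₀ y.1) : E →L[ℝ] ℝ))⟩

theorem extChartAt_symm_T {v : TQ E Q} {y : E × E}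
    (hy : y.1 ∈ (extChartAt 𝓘(ℝ, E) v.proj).target) :
    (extChartAt (IT E) v).symm y = invT v.proj y := by
  rw [FiberBundle.extChartAt]
  refine Eq.trans ((trivializationAt E (TangentSpace 𝓘(ℝ, E)) v.proj).mk_symm
    (symm_mem_baseSet hy) y.2).symm ?_
  exact congrArg (TotalSpace.mk _)
    (Trivialization.symmL_apply (R := ℝ) _ (symm_mem_baseSet hy) y.2).symm

theorem trivial_symmL (q₀ q : Q) (r : ℝ) :
    (trivializationAt ℝ (Bundle.Trivial Q ℝ) q₀).symmL ℝ q r = r := by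
  rw [Trivialization.symmL_apply _ (mem_univ _)]
  exact Bundle.Trivial.trivialization_symm_apply _ _ _ _

theorem extChartAt_symm_TStar (a : TStarQ E Q) (y : E × (E →L[ℝ] ℝ)) :
    (extChartAt (ITStar E) a).symm y = invTStar a.proj y := by
  rw [FiberBundle.extChartAt]
  refine congrArg (TotalSpace.mk _) ?_
  ext u
  exact trivial_symmL _ _ _

theorem cotangent_symm {q₀ : Q} {x : E} (hx : x ∈ (extChartAt 𝓘(ℝ, E) q₀).target)
    (α : E →L[ℝ] ℝ) :
    (trivializationAt (E →L[ℝ] ℝ) (CotangentSpace E Q) q₀).symm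
      ((extChartAt 𝓘(ℝ, E) q₀).symm x) α = (α.comp (coframe q₀ x) : E →L[ℝ] ℝ) := by
  have h := (trivializationAt (E →L[ℝ] ℝ) (CotangentSpace E Q) q₀).mk_symm
    (b := (extChartAt 𝓘(ℝ, E) q₀).symm x) ⟨symm_mem_baseSet hx, mem_univ _⟩ α
  have h2 := extChartAt_symm_TStar (⟨q₀, 0⟩ : TStarQ E Q) (x, α)
  rw [FiberBundle.extChartAt] at h2
  exact eq_of_heq (TotalSpace.mk.inj (h.trans h2)).2

theorem extChartAt_symm_W {w : Pontryagin E Q} {y : E × (E × (E →L[ℝ] ℝ))}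
    (hy : y.1 ∈ (extChartAt 𝓘(ℝ, E) w.proj).target) :
    (extChartAt (IW E) w).symm y = invW w.proj y := by
  rw [FiberBundle.extChartAt]
  refine congrArg (TotalSpace.mk _) ?_
  exact Prod.ext (Trivialization.symmL_apply (R := ℝ) _ (symm_mem_baseSet hy) y.2.1).symm (cotangent_symm hy y.2.2)

theorem mem_target_T {v : TQ E Q} {y : E × E}
    (hy : y.1 ∈ (extChartAt 𝓘(ℝ, E) v.proj).target) : y ∈ (extChartAt (IT E) v).target := by
  rw [FiberBundle.extChartAt_target]
  exact ⟨⟨hy, symm_mem_baseSet hy⟩, mem_univ _⟩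

theorem mem_target_TStar {a : TStarQ E Q} {y : E × (E →L[ℝ] ℝ)}
    (hy : y.1 ∈ (extChartAt 𝓘(ℝ, E) a.proj).target) : y ∈ (extChartAt (ITStar E) a).target := by
  rw [FiberBundle.extChartAt_target]
  exact ⟨⟨hy, symm_mem_baseSet hy, mem_univ _⟩, mem_univ _⟩

theorem mem_target_W {w : Pontryagin E Q} {y : E × (E × (E →L[ℝ] ℝ))}
    (hy : y.1 ∈ (extChartAt 𝓘(ℝ, E) w.proj).target) : y ∈ (extChartAt (IW E) w).target := by
  rw [FiberBundle.extChartAt_target]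
  exact ⟨⟨hy, symm_mem_baseSet hy, symm_mem_baseSet hy, mem_univ _⟩, mem_univ _⟩

theorem extChartAt_invT {v : TQ E Q} {y : E × E}
    (hy : y.1 ∈ (extChartAt 𝓘(ℝ, E) v.proj).target) :
    extChartAt (IT E) v (invT v.proj y) = y := by
  rw [← extChartAt_symm_T hy, PartialEquiv.right_inv _ (mem_target_T hy)]

theorem extChartAt_invTStar {a : TStarQ E Q} {y : E × (E →L[ℝ] ℝ)}
    (hy : y.1 ∈ (extChartAt 𝓘(ℝ, E) a.proj).target) :
    extChartAt (ITStar E) a (invTStar a.proj y) = y := by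
  rw [← extChartAt_symm_TStar, PartialEquiv.right_inv _ (mem_target_TStar hy)]

theorem extChartAt_invW {w : Pontryagin E Q} {y : E × (E × (E →L[ℝ] ℝ))}
    (hy : y.1 ∈ (extChartAt 𝓘(ℝ, E) w.proj).target) :
    extChartAt (IW E) w (invW w.proj y) = y := by
  rw [← extChartAt_symm_W hy, PartialEquiv.right_inv _ (mem_target_W hy)]

theorem invT_base (v : TQ E Q) : invT v.proj (extChartAt 𝓘(ℝ, E) v.proj v.proj, v.snd) = v := by
  unfold invT
  rw [frame_self, extChartAt_to_inv]
  rfl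

theorem invTStar_base (a : TStarQ E Q) :
    invTStar a.proj (extChartAt 𝓘(ℝ, E) a.proj a.proj, a.snd) = a := by
  unfold invTStar
  rw [coframe_self, extChartAt_to_inv]
  rfl

theorem invW_base (w : Pontryagin E Q) :
    invW w.proj (extChartAt 𝓘(ℝ, E) w.proj w.proj, w.snd) = w := by
  unfold invW
  rw [coframe_self, frame_self, extChartAt_to_inv]
  rfl

theorem extChartAt_T_self (v : TQ E Q) :
    extChartAt (IT E) v v = (extChartAt 𝓘(ℝ, E) v.proj v.proj, v.snd) := by
  have h := extChartAt_invT (v := v)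
    (y := (extChartAt 𝓘(ℝ, E) v.proj v.proj, v.snd)) (mem_extChartAt_target _)
  rwa [invT_base] at h

theorem extChartAt_TStar_self (a : TStarQ E Q) :
    extChartAt (ITStar E) a a = (extChartAt 𝓘(ℝ, E) a.proj a.proj, a.snd) := by
  have h := extChartAt_invTStar (a := a)
    (y := (extChartAt 𝓘(ℝ, E) a.proj a.proj, a.snd)) (mem_extChartAt_target _)
  rwa [invTStar_base] at h

theorem extChartAt_W_self (w : Pontryagin E Q) :
    extChartAt (IW E) w w = (extChartAt 𝓘(ℝ, E) w.proj w.proj, w.snd) := by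
  have h := extChartAt_invW (w := w)
    (y := (extChartAt 𝓘(ℝ, E) w.proj w.proj, w.snd)) (mem_extChartAt_target _)
  rwa [invW_base] at h

theorem contMDiff_tau : ContMDiff (IT E) 𝓘(ℝ, E) ∞ (tau (E := E) (Q := Q)) :=
  contMDiff_proj _

theorem contMDiff_piQ : ContMDiff (ITStar E) 𝓘(ℝ, E) ∞ (piQ (E := E) (Q := Q)) :=
  contMDiff_proj _

theorem contMDiff_pr₁ : ContMDiff (IW E) (IT E) ∞ (pr₁ (E := E) (Q := Q)) := by
  intro w
  have h := contMDiffAt_totalSpace.1 (contMDiffAt_id (I := IW E) (x := w) (n := ∞))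
  refine contMDiffAt_totalSpace.2 ⟨h.1, ?_⟩
  exact (contDiff_fst (𝕜 := ℝ) (E := E) (F := E →L[ℝ] ℝ)).contMDiff.contMDiffAt.comp w h.2

theorem contMDiff_pr₂ : ContMDiff (IW E) (ITStar E) ∞ (pr₂ (E := E) (Q := Q)) := by
  intro w
  have h := contMDiffAt_totalSpace.1 (contMDiffAt_id (I := IW E) (x := w) (n := ∞))
  refine contMDiffAt_totalSpace.2 ⟨h.1, ?_⟩
  exact (contDiff_snd (𝕜 := ℝ) (E := E) (F := E →L[ℝ] ℝ)).contMDiff.contMDiffAt.comp w h.2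

/-- A map into `TQ ⊕ T^*Q` with smooth components is smooth. -/
theorem contMDiffAt_whitney {E' H' M : Type*} [NormedAddCommGroup E'] [NormedSpace ℝ E']
    [TopologicalSpace H'] {I : ModelWithCorners ℝ E' H'} [TopologicalSpace M] [ChartedSpace H' M]
    {f : M → Pontryagin E Q} {x : M}
    (h₁ : ContMDiffAt I (IT E) ∞ (fun z => pr₁ (f z)) x)
    (h₂ : ContMDiffAt I (ITStar E) ∞ (fun z => pr₂ (f z)) x) :
    ContMDiffAt I (IW E) ∞ f x := by
  rw [contMDiffAt_totalSpace] at h₁ h₂ ⊢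
  refine ⟨h₁.1, ?_⟩
  exact h₁.2.prodMk_space h₂.2

theorem contMDiff_fibre (q : Q) :
    ContMDiff 𝓘(ℝ, E) (IT E) ∞ (fun u : E => (⟨q, u⟩ : TQ E Q)) := by
  intro u
  refine contMDiffAt_totalSpace.2 ⟨contMDiffAt_const, ?_⟩
  refine ContDiffAt.contMDiffAt ?_
  have h : (fun z : E => ((trivializationAt E (TangentSpace 𝓘(ℝ, E)) q) (⟨q, z⟩ : TQ E Q)).2) =
      coframe q (extChartAt 𝓘(ℝ, E) q q) := by
    ext z
    unfold coframe
    rw [extChartAt_to_inv]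
    exact (Trivialization.continuousLinearMapAt_apply_of_mem (R := ℝ) _
      (mem_baseSet_trivializationAt _ _ _) _).symm
  exact h ▸ (coframe q (extChartAt 𝓘(ℝ, E) q q)).contDiff.contDiffAt

/-! ### The Lagrangian, the Legendre map and the projections in coordinates. -/

variable (L : TQ E Q → ℝ)

/-- The Lagrangian in the bundle chart over the chart at `q₀`. -/
def localL (q₀ : Q) (y : E × E) : ℝ := L (invT q₀ y)

/-- The momenta `∂L/∂v` in the bundle chart over the chart at `q₀`. -/
def localP (q₀ : Q) (y : E × E) : E →L[ℝ] ℝ :=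
  (fderiv ℝ (localL L q₀) y).comp (ContinuousLinearMap.inr ℝ E E)

variable {L}

theorem eventually_mem_target_T (v : TQ E Q) : ∀ᶠ y in 𝓝 (extChartAt (IT E) v v),
    y.1 ∈ (extChartAt 𝓘(ℝ, E) v.proj).target := by
  rw [extChartAt_T_self]
  exact continuous_fst.continuousAt.eventually (extChartAt_target_mem_nhds (I := 𝓘(ℝ, E)) v.proj)

theorem eventually_mem_target_TStar (a : TStarQ E Q) : ∀ᶠ y in 𝓝 (extChartAt (ITStar E) a a),
    y.1 ∈ (extChartAt 𝓘(ℝ, E) a.proj).target := by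
  rw [extChartAt_TStar_self]
  exact continuous_fst.continuousAt.eventually (extChartAt_target_mem_nhds (I := 𝓘(ℝ, E)) a.proj)

theorem eventually_mem_target_W (w : Pontryagin E Q) : ∀ᶠ y in 𝓝 (extChartAt (IW E) w w),
    y.1 ∈ (extChartAt 𝓘(ℝ, E) w.proj).target := by
  rw [extChartAt_W_self]
  exact continuous_fst.continuousAt.eventually (extChartAt_target_mem_nhds (I := 𝓘(ℝ, E)) w.proj)

theorem contMDiffAt_invT {q₀ : Q} {y : E × E} (hy : y.1 ∈ (extChartAt 𝓘(ℝ, E) q₀).target) :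
    ContMDiffAt 𝓘(ℝ, E × E) (IT E) ∞ (invT q₀) y := by
  have hopen : IsOpen {y : E × E | y.1 ∈ (extChartAt 𝓘(ℝ, E) q₀).target} :=
    (isOpen_extChartAt_target q₀).preimage continuous_fst
  have h := (contMDiffOn_extChartAt_symm (I := IT E) (n := ∞) (⟨q₀, 0⟩ : TQ E Q)).contMDiffAt
    (x := y) ((isOpen_extChartAt_target (I := IT E) (⟨q₀, 0⟩ : TQ E Q)).mem_nhds (mem_target_T hy))
  refine h.congr_of_eventuallyEq ?_
  filter_upwards [hopen.mem_nhds hy] with z hz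
  exact (extChartAt_symm_T (v := (⟨q₀, 0⟩ : TQ E Q)) hz).symm

theorem contDiffAt_localL (hL : ContMDiff (IT E) 𝓘(ℝ, ℝ) ∞ L) {q₀ : Q} {y : E × E}
    (hy : y.1 ∈ (extChartAt 𝓘(ℝ, E) q₀).target) : ContDiffAt ℝ ∞ (localL L q₀) y :=
  (hL.contMDiffAt.comp y (contMDiffAt_invT hy)).contDiffAt

theorem contDiffAt_localP (hL : ContMDiff (IT E) 𝓘(ℝ, ℝ) ∞ L) {q₀ : Q} {y : E × E}
    (hy : y.1 ∈ (extChartAt 𝓘(ℝ, E) q₀).target) : ContDiffAt ℝ ∞ (localP L q₀) y :=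
  ((contDiffAt_localL hL hy).fderiv_right (m := ∞) le_rfl).clm_comp contDiffAt_const

theorem dFun_vLift (hL : ContMDiff (IT E) 𝓘(ℝ, ℝ) ∞ L) (v : TQ E Q) (u : E) :
    dFun (IT E) L v (vLift v u) = fderiv ℝ (fun u : E => L ⟨v.proj, u⟩) v.snd u := by
  have h1 := mfderiv_comp (I := 𝓘(ℝ, E)) (I' := IT E) (I'' := 𝓘(ℝ, ℝ)) (x := v.snd) (g := L)
    (f := fun u : E => (⟨v.proj, u⟩ : TQ E Q)) (hL.mdifferentiableAt (by simp))
    ((contMDiff_fibre v.proj).mdifferentiableAt (by simp))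
  have h2 := congrArg (fun A : E →L[ℝ] ℝ => A u) ((mfderiv_eq_fderiv).symm.trans h1)
  exact h2.symm

/-- The fibre derivative of `L` in the bundle chart. -/
theorem fderiv_fibre_comp_frame (hL : ContMDiff (IT E) 𝓘(ℝ, ℝ) ∞ L) {q₀ : Q} {y : E × E}
    (hy : y.1 ∈ (extChartAt 𝓘(ℝ, E) q₀).target) (u : E) :
    fderiv ℝ (fun u : E => L ⟨(invT q₀ y).proj, u⟩) (invT q₀ y).snd (frame q₀ y.1 u) =
      localP L q₀ y u := by
  have h1 : HasFDerivAt (fun e : E => localL L q₀ (y.1, e)) (localP L q₀ y) y.2 := by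
    have := ((contDiffAt_localL hL hy).differentiableAt (by simp)).hasFDerivAt
    exact HasFDerivAt.comp (f := fun e : E => (y.1, e)) y.2 this (hasFDerivAt_prodMk_right y.1 y.2)
  have h2 : DifferentiableAt ℝ (fun u : E => L ⟨(invT q₀ y).proj, u⟩) (frame q₀ y.1 y.2) :=
    (hL.comp (contMDiff_fibre _)).contDiff.differentiable (by simp) _
  have h3 := HasFDerivAt.comp (f := fun e : E => frame q₀ y.1 e) y.2 h2.hasFDerivAt
    (frame q₀ y.1).hasFDerivAt
  exact congrArg (fun A : E →L[ℝ] ℝ => A u) (h3.unique h1)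

theorem legendre_invT (hL : ContMDiff (IT E) 𝓘(ℝ, ℝ) ∞ L) {q₀ : Q} {y : E × E}
    (hy : y.1 ∈ (extChartAt 𝓘(ℝ, E) q₀).target) :
    legendre L (invT q₀ y) = invTStar q₀ (y.1, localP L q₀ y) := by
  refine congrArg (TotalSpace.mk _) ?_
  refine ContinuousLinearMap.ext (M₁ := E) fun u => ?_
  have h := fderiv_fibre_comp_frame hL hy (coframe q₀ y.1 u)
  have h2 : frame q₀ y.1 (coframe q₀ y.1 u) = u := frame_coframe hy u
  exact (congrArg _ h2).symm.trans h

theorem mfderiv_pr₁ (w : Pontryagin E Q) (X : E × (E × (E →L[ℝ] ℝ))) :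
    mfderiv (IW E) (IT E) pr₁ w X = ((X.1, X.2.1) : E × E) := by
  let F : E × (E × (E →L[ℝ] ℝ)) →L[ℝ] E × E :=
    (ContinuousLinearMap.fst ℝ _ _).prod
      ((ContinuousLinearMap.fst ℝ _ _).comp (ContinuousLinearMap.snd ℝ _ _))
  have h : HasMFDerivAt (IW E) (IT E) pr₁ w F := by
    refine hasMFDerivAt_of_eventuallyEq_chart contMDiff_pr₁.continuous.continuousAt (F := F) ?_
      F.hasFDerivAt
    filter_upwards [eventually_mem_target_W w] with y hy
    rw [extChartAt_symm_W hy]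
    exact extChartAt_invT (v := pr₁ w) (y := (y.1, y.2.1)) hy
  rw [h.mfderiv]
  rfl

theorem mfderiv_pr₂ (w : Pontryagin E Q) (X : E × (E × (E →L[ℝ] ℝ))) :
    mfderiv (IW E) (ITStar E) pr₂ w X = ((X.1, X.2.2) : E × (E →L[ℝ] ℝ)) := by
  let F : E × (E × (E →L[ℝ] ℝ)) →L[ℝ] E × (E →L[ℝ] ℝ) :=
    (ContinuousLinearMap.fst ℝ _ _).prod
      ((ContinuousLinearMap.snd ℝ _ _).comp (ContinuousLinearMap.snd ℝ _ _))
  have h : HasMFDerivAt (IW E) (ITStar E) pr₂ w F := by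
    refine hasMFDerivAt_of_eventuallyEq_chart contMDiff_pr₂.continuous.continuousAt (F := F) ?_
      F.hasFDerivAt
    filter_upwards [eventually_mem_target_W w] with y hy
    rw [extChartAt_symm_W hy]
    exact extChartAt_invTStar (a := pr₂ w) (y := (y.1, y.2.2)) hy
  rw [h.mfderiv]
  rfl

theorem mfderiv_tau (v : TQ E Q) (X : E × E) :
    mfderiv (IT E) 𝓘(ℝ, E) tau v X = X.1 := by
  have h : HasMFDerivAt (IT E) 𝓘(ℝ, E) tau v (ContinuousLinearMap.fst ℝ E E) := by
    refine hasMFDerivAt_of_eventuallyEq_chart contMDiff_tau.continuous.continuousAt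
      (F := Prod.fst) ?_ hasFDerivAt_fst
    filter_upwards [eventually_mem_target_T v] with y hy
    rw [extChartAt_symm_T hy]
    exact (extChartAt 𝓘(ℝ, E) v.proj).right_inv hy
  rw [h.mfderiv]
  rfl

theorem vLift_apply (v : TQ E Q) (u : E) : vLift v u = ((0, u) : E × E) := by
  have h : HasMFDerivAt 𝓘(ℝ, E) (IT E) (fun u : E => (⟨v.proj, u⟩ : TQ E Q)) v.snd
      (ContinuousLinearMap.inr ℝ E E) := by
    refine hasMFDerivAt_of_eventuallyEq_chart (contMDiff_fibre v.proj).continuous.continuousAt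
      (F := fun u => (extChartAt 𝓘(ℝ, E) v.proj v.proj, u)) ?_ (hasFDerivAt_prodMk_right _ _)
    exact Filter.Eventually.of_forall fun y => extChartAt_T_self (⟨v.proj, y⟩ : TQ E Q)
  unfold vLift
  rw [h.mfderiv]
  rfl

theorem hasMFDerivAt_extChartAt_symm_fst {F : Type*} [NormedAddCommGroup F] [NormedSpace ℝ F]
    {q₀ : Q} {y : E × F} (hy : y.1 ∈ (extChartAt 𝓘(ℝ, E) q₀).target) :
    HasMFDerivAt 𝓘(ℝ, E × F) 𝓘(ℝ, E) (fun y : E × F => (extChartAt 𝓘(ℝ, E) q₀).symm y.1) y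
      ((frame q₀ y.1).comp (ContinuousLinearMap.fst ℝ E F)) := by
  have h3 : MDifferentiableAt 𝓘(ℝ, E) 𝓘(ℝ, E) (extChartAt 𝓘(ℝ, E) q₀).symm y.1 :=
    ((contMDiffOn_extChartAt_symm (I := 𝓘(ℝ, E)) (n := ∞) q₀).contMDiffAt
      ((isOpen_extChartAt_target q₀).mem_nhds hy)).mdifferentiableAt (by simp)
  have h4 := h3.hasMFDerivAt
  rw [mfderiv_extChartAt_symm hy] at h4
  have h5 : HasFDerivAt (Prod.fst : E × F → E) (ContinuousLinearMap.fst ℝ E F) y := hasFDerivAt_fst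
  exact HasMFDerivAt.comp (I := 𝓘(ℝ, E × F)) (f := Prod.fst) y h4 h5.hasMFDerivAt

/-- The chart expression of the base component of a tangent vector of `TQ`. -/
theorem mfderiv_tau_mfderiv_symm {v : TQ E Q} {y : E × E}
    (hy : y.1 ∈ (extChartAt 𝓘(ℝ, E) v.proj).target) (Y : E × E) :
    mfderiv (IT E) 𝓘(ℝ, E) (tau (E := E) (Q := Q)) ((extChartAt (IT E) v).symm y)
      (mfderiv 𝓘(ℝ, E × E) (IT E) (extChartAt (IT E) v).symm y Y) = frame v.proj y.1 Y.1 := by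
  have h1 : MDifferentiableAt 𝓘(ℝ, E × E) (IT E) (extChartAt (IT E) v).symm y :=
    ((contMDiffOn_extChartAt_symm (I := IT E) (n := ∞) v).contMDiffAt
      ((isOpen_extChartAt_target v).mem_nhds (mem_target_T hy))).mdifferentiableAt (by simp)
  have h2 := HasMFDerivAt.comp y
    (contMDiff_tau.mdifferentiableAt (x := (extChartAt (IT E) v).symm y) (by simp)).hasMFDerivAt
    h1.hasMFDerivAt
  have h3 := (hasMFDerivAt_extChartAt_symm_fst (F := E) hy).congr_of_eventuallyEq
    (f₁ := tau ∘ (extChartAt (IT E) v).symm) <| by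
      filter_upwards [((isOpen_extChartAt_target (I := 𝓘(ℝ, E)) v.proj).preimage
        continuous_fst).mem_nhds hy] with z hz
      exact congrArg tau (extChartAt_symm_T (v := v) hz)
  exact congrArg (fun A : E × E →L[ℝ] E => A Y) (hasMFDerivAt_unique h2 h3)

theorem mfderiv_piQ_mfderiv_symm {a : TStarQ E Q} {y : E × (E →L[ℝ] ℝ)}
    (hy : y.1 ∈ (extChartAt 𝓘(ℝ, E) a.proj).target) (Y : E × (E →L[ℝ] ℝ)) :
    mfderiv (ITStar E) 𝓘(ℝ, E) (piQ (E := E) (Q := Q)) ((extChartAt (ITStar E) a).symm y)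
      (mfderiv 𝓘(ℝ, E × (E →L[ℝ] ℝ)) (ITStar E) (extChartAt (ITStar E) a).symm y Y) =
      frame a.proj y.1 Y.1 := by
  have h1 : MDifferentiableAt 𝓘(ℝ, E × (E →L[ℝ] ℝ)) (ITStar E) (extChartAt (ITStar E) a).symm y :=
    ((contMDiffOn_extChartAt_symm (I := ITStar E) (n := ∞) a).contMDiffAt
      ((isOpen_extChartAt_target a).mem_nhds (mem_target_TStar hy))).mdifferentiableAt (by simp)
  have h2 := HasMFDerivAt.comp y
    (contMDiff_piQ.mdifferentiableAt (x := (extChartAt (ITStar E) a).symm y)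
      (by simp)).hasMFDerivAt h1.hasMFDerivAt
  have h3 := (hasMFDerivAt_extChartAt_symm_fst (F := E →L[ℝ] ℝ) hy).congr_of_eventuallyEq
    (f₁ := piQ ∘ (extChartAt (ITStar E) a).symm)
    (Filter.Eventually.of_forall fun z => congrArg piQ (extChartAt_symm_TStar a z))
  exact congrArg (fun A : E × (E →L[ℝ] ℝ) →L[ℝ] E => A Y) (hasMFDerivAt_unique h2 h3)

theorem contMDiffAt_invTStar {q₀ : Q} {y : E × (E →L[ℝ] ℝ)}
    (hy : y.1 ∈ (extChartAt 𝓘(ℝ, E) q₀).target) :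
    ContMDiffAt 𝓘(ℝ, E × (E →L[ℝ] ℝ)) (ITStar E) ∞ (invTStar q₀) y := by
  have h := (contMDiffOn_extChartAt_symm (I := ITStar E) (n := ∞)
    (⟨q₀, 0⟩ : TStarQ E Q)).contMDiffAt (x := y)
    ((isOpen_extChartAt_target (I := ITStar E) (⟨q₀, 0⟩ : TStarQ E Q)).mem_nhds
      (mem_target_TStar hy))
  refine h.congr_of_eventuallyEq ?_
  exact Filter.Eventually.of_forall fun z =>
    (extChartAt_symm_TStar (⟨q₀, 0⟩ : TStarQ E Q) z).symm

theorem contMDiff_legendre (hL : ContMDiff (IT E) 𝓘(ℝ, ℝ) ∞ L) :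
    ContMDiff (IT E) (ITStar E) ∞ (legendre L) := by
  intro v
  have hv : (extChartAt (IT E) v v).1 ∈ (extChartAt 𝓘(ℝ, E) v.proj).target := by
    rw [extChartAt_T_self]
    exact mem_extChartAt_target _
  have h1 : ContMDiffAt (IT E) 𝓘(ℝ, E × E) ∞ (extChartAt (IT E) v) v := contMDiffAt_extChartAt
  have h2 : ContMDiffAt 𝓘(ℝ, E × E) 𝓘(ℝ, E × (E →L[ℝ] ℝ)) ∞
      (fun y => (y.1, localP L v.proj y)) (extChartAt (IT E) v v) :=
    (contDiffAt_fst.prodMk (contDiffAt_localP hL hv)).contMDiffAt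
  have h3 := (contMDiffAt_invTStar (q₀ := v.proj) (y := ((extChartAt (IT E) v v).1,
    localP L v.proj (extChartAt (IT E) v v))) hv)
  have h4 := (ContMDiffAt.comp (g := invTStar v.proj) (f := fun y => (y.1, localP L v.proj y))
    (extChartAt (IT E) v v) h3 h2).comp v h1
  refine h4.congr_of_eventuallyEq ?_
  filter_upwards [extChartAt_source_mem_nhds (I := IT E) v,
    (continuousAt_extChartAt (I := IT E) v).eventually (eventually_mem_target_T v)] with z hz hz'
  have h5 := (extChartAt (IT E) v).left_inv hz
  rw [extChartAt_symm_T hz'] at h5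
  conv_lhs => rw [← h5]
  exact legendre_invT hL hz'

theorem mfderiv_legendre (hL : ContMDiff (IT E) 𝓘(ℝ, ℝ) ∞ L) (v : TQ E Q) (X : E × E) :
    mfderiv (IT E) (ITStar E) (legendre L) v X =
      ((X.1, fderiv ℝ (localP L v.proj) (extChartAt (IT E) v v) X) : E × (E →L[ℝ] ℝ)) := by
  have hv := (eventually_mem_target_T v).self_of_nhds
  have h1 : HasFDerivAt (Prod.fst : E × E → E) (ContinuousLinearMap.fst ℝ E E)
    (extChartAt (IT E) v v) := hasFDerivAt_fst
  have h : HasMFDerivAt (IT E) (ITStar E) (legendre L) v ((ContinuousLinearMap.fst ℝ E E).prod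
      (fderiv ℝ (localP L v.proj) (extChartAt (IT E) v v))) := by
    refine hasMFDerivAt_of_eventuallyEq_chart (contMDiff_legendre hL).continuous.continuousAt
      (F := fun y => (y.1, localP L v.proj y)) ?_ (h1.prodMk
        ((contDiffAt_localP hL hv).differentiableAt (by simp)).hasFDerivAt)
    filter_upwards [eventually_mem_target_T v] with y hy
    rw [extChartAt_symm_T hy, legendre_invT hL hy]
    exact extChartAt_invTStar (a := legendre L v) (y := (y.1, localP L v.proj y)) hy
  rw [h.mfderiv]
  rfl

/-! ### The canonical forms and the energies in coordinates. -/

theorem hasFDerivAt_comp_clm {E F G : Type*} [NormedAddCommGroup E] [NormedSpace ℝ E]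
    [NormedAddCommGroup F] [NormedSpace ℝ F] [NormedAddCommGroup G] [NormedSpace ℝ G]
    (P : G → E →L[ℝ] ℝ) {P' : G →L[ℝ] E →L[ℝ] ℝ} {y : G} (h : HasFDerivAt P P' y)
    (p : F →L[ℝ] E) :
    HasFDerivAt (fun y => (P y).comp p) ((ContinuousLinearMap.precomp ℝ p).comp P') y :=
  let β : (E →L[ℝ] ℝ) →L[ℝ] F →L[ℝ] ℝ := ContinuousLinearMap.precomp ℝ p
  β.hasFDerivAt.comp y h

/-- In the chart the Liouville form is `p dq`: the frame from the derivative of `piQ` cancels the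
coframe in the fibre coordinate. -/
theorem OmegaQ_apply (a : TStarQ E Q) (X Y : E × (E →L[ℝ] ℝ)) :
    OmegaQ a X Y = Y.2 X.1 - X.2 Y.1 := by
  have h1 : HasFDerivAt (Prod.snd : E × (E →L[ℝ] ℝ) → E →L[ℝ] ℝ)
    (ContinuousLinearMap.snd ℝ E (E →L[ℝ] ℝ)) (extChartAt (ITStar E) a a) := hasFDerivAt_snd
  have h := extD_eq_of_chartForm (I := ITStar E) (α := thetaQ (E := E) (Q := Q)) (x := a)
    ?_ (hasFDerivAt_comp_clm _ h1 (ContinuousLinearMap.fst ℝ E (E →L[ℝ] ℝ))) X Y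
  · unfold OmegaQ
    rw [h]
    exact neg_sub _ _
  · filter_upwards [eventually_mem_target_TStar a] with y hy
    refine ContinuousLinearMap.ext fun Y => ?_
    have h1 : chartForm (ITStar E) thetaQ a y Y = ((extChartAt (ITStar E) a).symm y).snd
      (frame a.proj y.1 Y.1) := congrArg (fun u => ((extChartAt (ITStar E) a).symm y).snd u)
        (mfderiv_piQ_mfderiv_symm hy Y)
    rw [h1, extChartAt_symm_TStar]
    exact congrArg y.2 (coframe_frame hy Y.1)

/-- In the chart `thetaL L` is again `p dq`, now with the momenta `p = ∂L/∂v` of `localP` as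
coefficients. -/
theorem OmegaL_apply (hL : ContMDiff (IT E) 𝓘(ℝ, ℝ) ∞ L) (v : TQ E Q) (X Y : E × E) :
    OmegaL L v X Y = fderiv ℝ (localP L v.proj) (extChartAt (IT E) v v) Y X.1 -
      fderiv ℝ (localP L v.proj) (extChartAt (IT E) v v) X Y.1 := by
  have hv := (eventually_mem_target_T v).self_of_nhds
  have h := extD_eq_of_chartForm (I := IT E) (α := thetaL L) (x := v)
    ?_ (hasFDerivAt_comp_clm _ ((contDiffAt_localP hL hv).differentiableAt (by simp)).hasFDerivAt
      (ContinuousLinearMap.fst ℝ E E)) X Y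
  · unfold OmegaL
    rw [h]
    exact neg_sub _ _
  · filter_upwards [eventually_mem_target_T v] with y hy
    refine ContinuousLinearMap.ext fun Y => ?_
    have h1 : chartForm (IT E) (thetaL L) v y Y =
        dFun (IT E) L ((extChartAt (IT E) v).symm y) (vLift _ (frame v.proj y.1 Y.1)) :=
      congrArg (fun u => dFun (IT E) L ((extChartAt (IT E) v).symm y) (vLift _ u))
        (mfderiv_tau_mfderiv_symm hy Y)
    rw [h1, dFun_vLift hL, extChartAt_symm_T hy]
    exact fderiv_fibre_comp_frame hL hy Y.1

theorem energyL_invT (hL : ContMDiff (IT E) 𝓘(ℝ, ℝ) ∞ L) {q₀ : Q} {y : E × E}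
    (hy : y.1 ∈ (extChartAt 𝓘(ℝ, E) q₀).target) :
    energyL L (invT q₀ y) = localP L q₀ y y.2 - localL L q₀ y := by
  unfold energyL liouville
  exact congrArg (· - localL L q₀ y) ((dFun_vLift hL (invT q₀ y) (invT q₀ y).snd).trans
    (fderiv_fibre_comp_frame hL hy y.2))

theorem contMDiff_energyL (hL : ContMDiff (IT E) 𝓘(ℝ, ℝ) ∞ L) :
    ContMDiff (IT E) 𝓘(ℝ, ℝ) ∞ (energyL L) := by
  intro v
  have hv := (eventually_mem_target_T v).self_of_nhds
  have h2 : ContMDiffAt 𝓘(ℝ, E × E) 𝓘(ℝ, ℝ) ∞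
      (fun y => localP L v.proj y y.2 - localL L v.proj y) (extChartAt (IT E) v v) :=
    (((contDiffAt_localP hL hv).clm_apply contDiffAt_snd).sub
      (contDiffAt_localL hL hv)).contMDiffAt
  refine (h2.comp v contMDiffAt_extChartAt).congr_of_eventuallyEq ?_
  filter_upwards [extChartAt_source_mem_nhds (I := IT E) v,
    (continuousAt_extChartAt (I := IT E) v).eventually (eventually_mem_target_T v)] with z hz hz'
  have h5 := (extChartAt (IT E) v).left_inv hz
  rw [extChartAt_symm_T hz'] at h5
  conv_lhs => rw [← h5]
  exact energyL_invT hL hz'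

theorem dFun_energyL (hL : ContMDiff (IT E) 𝓘(ℝ, ℝ) ∞ L) (v : TQ E Q) (Y : E × E) :
    dFun (IT E) (energyL L) v Y =
      fderiv ℝ (localP L v.proj) (extChartAt (IT E) v v) Y v.snd +
        localP L v.proj (extChartAt (IT E) v v) Y.2 -
        fderiv ℝ (localL L v.proj) (extChartAt (IT E) v v) Y := by
  have hv := (eventually_mem_target_T v).self_of_nhds
  have h1 := ((contDiffAt_localP hL hv).differentiableAt (by simp)).hasFDerivAt
  have h2 := ((contDiffAt_localL hL hv).differentiableAt (by simp)).hasFDerivAt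
  have h3 : (extChartAt (IT E) v v).2 = v.snd := by rw [extChartAt_T_self]
  have h4 : HasFDerivAt (Prod.snd : E × E → E) (ContinuousLinearMap.snd ℝ E E)
    (extChartAt (IT E) v v) := hasFDerivAt_snd
  have h5 := (h1.clm_apply h4).sub h2
  rw [h3] at h5
  have h := hasMFDerivAt_of_eventuallyEq_chart (I := IT E) (I' := 𝓘(ℝ, ℝ)) (f := energyL L) (x := v)
    (contMDiff_energyL hL).continuous.continuousAt
    (F := fun y => localP L v.proj y y.2 - localL L v.proj y) ?_
    h5
  · refine (congrArg (fun A : E × E →L[ℝ] ℝ => A Y) h.mfderiv).trans ?_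
    refine congrArg (· - fderiv ℝ (localL L v.proj) (extChartAt (IT E) v v) Y) ?_
    exact add_comm _ _
  · filter_upwards [eventually_mem_target_T v] with y hy
    rw [extChartAt_symm_T hy]
    exact energyL_invT hL hy

theorem energyD_invW {q₀ : Q} {y : E × (E × (E →L[ℝ] ℝ))}
    (hy : y.1 ∈ (extChartAt 𝓘(ℝ, E) q₀).target) :
    energyD L (invW q₀ y) = y.2.2 y.2.1 - localL L q₀ (y.1, y.2.1) :=
  congrArg (fun u => y.2.2 u - localL L q₀ (y.1, y.2.1)) (coframe_frame hy y.2.1)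

theorem contMDiff_energyD (hL : ContMDiff (IT E) 𝓘(ℝ, ℝ) ∞ L) :
    ContMDiff (IW E) 𝓘(ℝ, ℝ) ∞ (energyD L) := by
  intro w
  have h1 : ContMDiffAt 𝓘(ℝ, E × (E × (E →L[ℝ] ℝ))) 𝓘(ℝ, ℝ) ∞
      (fun y => y.2.2 y.2.1) (extChartAt (IW E) w w) :=
    ((contDiffAt_snd.comp _ contDiffAt_snd).clm_apply
      (contDiffAt_fst.comp _ contDiffAt_snd)).contMDiffAt
  have h2 := (h1.comp w contMDiffAt_extChartAt).sub (hL.comp contMDiff_pr₁).contMDiffAt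
  refine h2.congr_of_eventuallyEq ?_
  filter_upwards [extChartAt_source_mem_nhds (I := IW E) w,
    (continuousAt_extChartAt (I := IW E) w).eventually (eventually_mem_target_W w)] with z hz hz'
  have h5 := (extChartAt (IW E) w).left_inv hz
  rw [extChartAt_symm_W hz'] at h5
  have h6 := energyD_invW (L := L) hz'
  have h7 : localL L w.proj ((extChartAt (IW E) w z).1, (extChartAt (IW E) w z).2.1) =
    L (pr₁ (invW w.proj (extChartAt (IW E) w z))) := rfl
  rw [h7, h5] at h6
  exact h6

theorem dFun_energyD (hL : ContMDiff (IT E) 𝓘(ℝ, ℝ) ∞ L) (w : Pontryagin E Q)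
    (Y : E × (E × (E →L[ℝ] ℝ))) :
    dFun (IW E) (energyD L) w Y = Y.2.2 w.snd.1 + (w.snd.2 : E →L[ℝ] ℝ) Y.2.1 -
        fderiv ℝ (localL L w.proj) (extChartAt (IT E) (pr₁ w) (pr₁ w)) (Y.1, Y.2.1) := by
  have hv := (eventually_mem_target_T (pr₁ w)).self_of_nhds
  have h2 := ((contDiffAt_localL hL hv).differentiableAt (by simp)).hasFDerivAt
  let F := E × (E × (E →L[ℝ] ℝ))
  let p₁ : F →L[ℝ] E × E := (ContinuousLinearMap.fst ℝ _ _).prod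
      ((ContinuousLinearMap.fst ℝ _ _).comp (ContinuousLinearMap.snd ℝ _ _))
  let p₂ : F →L[ℝ] E := (ContinuousLinearMap.fst ℝ _ _).comp (ContinuousLinearMap.snd ℝ _ _)
  let p₃ : F →L[ℝ] (E →L[ℝ] ℝ) :=
    (ContinuousLinearMap.snd ℝ _ _).comp (ContinuousLinearMap.snd ℝ _ _)
  have hw : p₁ (extChartAt (IW E) w w) = extChartAt (IT E) (pr₁ w) (pr₁ w) := by
    rw [extChartAt_W_self, extChartAt_T_self]
    rfl
  rw [← hw] at h2
  have h3 := HasFDerivAt.comp (f := p₁) _ h2 p₁.hasFDerivAt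
  have h5 := ((p₃.hasFDerivAt (x := extChartAt (IW E) w w)).clm_apply
    (p₂.hasFDerivAt (x := extChartAt (IW E) w w))).sub h3
  have h := hasMFDerivAt_of_eventuallyEq_chart (I := IW E) (I' := 𝓘(ℝ, ℝ)) (f := energyD L) (x := w)
    (contMDiff_energyD hL).continuous.continuousAt
    (F := fun y : F => p₃ y (p₂ y) - localL L w.proj (p₁ y)) ?_ h5
  · refine (congrArg (fun A : F →L[ℝ] ℝ => A Y) h.mfderiv).trans ?_
    rw [← hw]
    refine congrArg (· - fderiv ℝ (localL L w.proj) (p₁ (extChartAt (IW E) w w)) (Y.1, Y.2.1)) ?_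
    have h6 : p₂ (extChartAt (IW E) w w) = w.snd.1 := by rw [extChartAt_W_self]; rfl
    have h7 : p₃ (extChartAt (IW E) w w) = w.snd.2 := by rw [extChartAt_W_self]; rfl
    rw [h6, h7]
    exact add_comm _ _
  · filter_upwards [eventually_mem_target_W w] with y hy
    rw [extChartAt_symm_W hy]
    exact energyD_invW hy

/-! ### The Skinner-Rusk and Lagrangian equations at a point. -/

/-- The fibre component of a point of `TQ`, in the model space. -/
def velocity (v : TQ E Q) : E := v.snd

theorem legendre_eq_mk_localP (hL : ContMDiff (IT E) 𝓘(ℝ, ℝ) ∞ L) (v : TQ E Q) :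
    legendre L v =
      (⟨v.proj, (localP L v.proj (extChartAt (IT E) v v) : E →L[ℝ] ℝ)⟩ : TStarQ E Q) := by
  rw [extChartAt_T_self]
  have h := legendre_invT hL (q₀ := v.proj) (y := (extChartAt 𝓘(ℝ, E) v.proj v.proj, v.snd))
    (mem_extChartAt_target _)
  rw [invT_base] at h
  rw [h]
  exact invTStar_base ⟨v.proj, _⟩

/-- The derivative of the momenta is the second derivative of the Lagrangian. -/
theorem fderiv_localP (hL : ContMDiff (IT E) 𝓘(ℝ, ℝ) ∞ L) (v : TQ E Q) (X : E × E) (u : E) :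
    fderiv ℝ (localP L v.proj) (extChartAt (IT E) v v) X u =
      fderiv ℝ (fderiv ℝ (localL L v.proj)) (extChartAt (IT E) v v) X (0, u) := by
  have h := (contDiffAt_localL hL (eventually_mem_target_T v).self_of_nhds).fderiv_right
    (m := ∞) le_rfl
  have h2 := hasFDerivAt_comp_clm _ (h.differentiableAt (by simp)).hasFDerivAt
    (ContinuousLinearMap.inr ℝ E E)
  exact congrArg (fun A : E × E →L[ℝ] E →L[ℝ] ℝ => A X u) h2.fderiv

theorem fderiv_localP_vertical_symm (hL : ContMDiff (IT E) 𝓘(ℝ, ℝ) ∞ L) (v : TQ E Q) (a b : E) :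
    fderiv ℝ (localP L v.proj) (extChartAt (IT E) v v) (0, a) b =
      fderiv ℝ (localP L v.proj) (extChartAt (IT E) v v) (0, b) a := by
  rw [fderiv_localP hL, fderiv_localP hL]
  have h := (contDiffAt_localL hL (eventually_mem_target_T v).self_of_nhds).isSymmSndFDerivAt
    (by rw [minSmoothness_of_isRCLikeNormedField]; exact WithTop.coe_le_coe.2 le_top)
  exact h.eq _ _

/-- The Poincaré-Cartan form is the pullback of the canonical form by the Legendre map. -/
theorem OmegaL_eq_legendre (hL : ContMDiff (IT E) 𝓘(ℝ, ℝ) ∞ L) (v : TQ E Q) (X Y : E × E)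
    {a b : E × (E →L[ℝ] ℝ)} (ha : mfderiv (IT E) (ITStar E) (legendre L) v X = a)
    (hb : mfderiv (IT E) (ITStar E) (legendre L) v Y = b) :
    OmegaL L v X Y = b.2 a.1 - a.2 b.1 := by
  rw [mfderiv_legendre hL] at ha hb
  subst ha hb
  exact OmegaL_apply hL v X Y

/-- Write E_L = p(v) - L. A kernel vector is vertical and leaves p unchanged to first order; the two
terms left, p(dv) and dL, agree on vertical vectors. -/
theorem dFun_energyL_of_mfderiv_legendre_eq_zero (hL : ContMDiff (IT E) 𝓘(ℝ, ℝ) ∞ L) (v : TQ E Q)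
    (X : E × E)
    (h : mfderiv (IT E) (ITStar E) (legendre L) v X = (0 : E × (E →L[ℝ] ℝ))) :
    dFun (IT E) (energyL L) v X = 0 := by
  rw [mfderiv_legendre hL] at h
  obtain ⟨h1, h2⟩ := Prod.mk.inj h
  have h3 : X = (0, X.2) := Prod.ext h1 rfl
  rw [dFun_energyL hL, h2]
  have h4 : localP L v.proj (extChartAt (IT E) v v) X.2 =
    fderiv ℝ (localL L v.proj) (extChartAt (IT E) v v) (0, X.2) := rfl
  rw [h4, ← h3]
  exact (congrArg (· - _) (zero_add _)).trans (sub_self _)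

/-- A solution of the Lagrangian equation satisfies the second order condition up to the kernel of
the Legendre map. -/
theorem mfderiv_legendre_deviation (hL : ContMDiff (IT E) 𝓘(ℝ, ℝ) ∞ L) (v : TQ E Q) (X : E × E)
    (h : Solves (IT E) (OmegaL L) (energyL L) v X) :
    mfderiv (IT E) (ITStar E) (legendre L) v ((0, X.1 - velocity v) : E × E) =
      (0 : E × (E →L[ℝ] ℝ)) := by
  rw [mfderiv_legendre hL]
  refine Prod.ext rfl ?_
  refine ContinuousLinearMap.ext fun b => ?_
  -- On a vertical test vector the terms in `∂L/∂v` cancel, leaving the fibre Hessian of `L` paired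
  -- with `b` and `X.1 - velocity v`; symmetry of the Hessian does the rest.
  have h1 := h ((0, b) : E × E)
  rw [OmegaL_apply hL, dFun_energyL hL] at h1
  change _ = fderiv ℝ (localP L v.proj) (extChartAt (IT E) v v) (0, b) (velocity v) + _ - _ at h1
  have h2 : fderiv ℝ (localL L v.proj) (extChartAt (IT E) v v) (0, b) =
    localP L v.proj (extChartAt (IT E) v v) b := rfl
  change fderiv ℝ (localP L v.proj) (extChartAt (IT E) v v) (0, X.1 - velocity v) b = 0
  rw [fderiv_localP_vertical_symm hL]
  have h3 : fderiv ℝ (localP L v.proj) (extChartAt (IT E) v v) (0, b) (X.1 - velocity v) =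
    fderiv ℝ (localP L v.proj) (extChartAt (IT E) v v) (0, b) X.1 -
    fderiv ℝ (localP L v.proj) (extChartAt (IT E) v v) (0, b) (velocity v) := map_sub _ _ _
  simp only [h2, map_zero, sub_zero] at h1
  rw [h3]
  linarith

theorem vertS_eq_liouville_iff (v : TQ E Q) (X : E × E) :
    vertS v X = liouville v ↔ X.1 = v.snd := by
  have h1 : vertS v X = ((0, X.1) : E × E) :=
    (congrArg (vLift v) (mfderiv_tau v X)).trans (vLift_apply v X.1)
  have h2 : liouville v = ((0, v.snd) : E × E) := vLift_apply v v.snd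
  rw [h1, h2]
  exact ⟨fun h => (Prod.mk.inj h).2, fun h => congrArg (Prod.mk (0 : E)) h⟩

theorem Omega_apply (w : Pontryagin E Q) (X Y : E × (E × (E →L[ℝ] ℝ))) :
    Omega w X Y = Y.2.2 X.1 - X.2.2 Y.1 := by
  unfold Omega
  rw [mfderiv_pr₂, mfderiv_pr₂]
  exact OmegaQ_apply _ _ _

/-- The covector component of a point of `TQ ⊕ T^*Q`, in the model space. -/
def momentum (w : Pontryagin E Q) : E →L[ℝ] ℝ := w.snd.2

theorem pr₂_eq_legendre_iff (hL : ContMDiff (IT E) 𝓘(ℝ, ℝ) ∞ L) {w : Pontryagin E Q} :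
    pr₂ w = legendre L (pr₁ w) ↔
      momentum w = localP L w.proj (extChartAt (IT E) (pr₁ w) (pr₁ w)) := by
  rw [legendre_eq_mk_localP hL]
  exact ⟨fun h => eq_of_heq (TotalSpace.mk.inj h).2, fun h => congrArg (TotalSpace.mk w.proj) h⟩

theorem solves_W_iff (hL : ContMDiff (IT E) 𝓘(ℝ, ℝ) ∞ L) {w : Pontryagin E Q}
    {X : E × (E × (E →L[ℝ] ℝ))} :
    Solves (IW E) Omega (energyD L) w X ↔ ∀ Y : E × (E × (E →L[ℝ] ℝ)),
      Y.2.2 X.1 - X.2.2 Y.1 = Y.2.2 (velocity (pr₁ w)) + momentum w Y.2.1 -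
        fderiv ℝ (localL L w.proj) (extChartAt (IT E) (pr₁ w) (pr₁ w)) (Y.1, Y.2.1) := by
  refine forall_congr' fun (Y : E × (E × (E →L[ℝ] ℝ))) => ?_
  rw [Omega_apply, dFun_energyD hL]
  rfl

theorem solves_L_iff (hL : ContMDiff (IT E) 𝓘(ℝ, ℝ) ∞ L) {v : TQ E Q} {X : E × E} :
    Solves (IT E) (OmegaL L) (energyL L) v X ↔ ∀ Y : E × E,
      fderiv ℝ (localP L v.proj) (extChartAt (IT E) v v) Y X.1 -
        fderiv ℝ (localP L v.proj) (extChartAt (IT E) v v) X Y.1 =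
      fderiv ℝ (localP L v.proj) (extChartAt (IT E) v v) Y (velocity v) +
        localP L v.proj (extChartAt (IT E) v v) Y.2 -
        fderiv ℝ (localL L v.proj) (extChartAt (IT E) v v) Y := by
  refine forall_congr' fun (Y : E × E) => ?_
  rw [OmegaL_apply hL, dFun_energyL hL]
  rfl

/-- The points at which the Skinner-Rusk equation is solvable lie on the graph of the Legendre
map. -/
theorem pr₂_eq_legendre_of_solves (hL : ContMDiff (IT E) 𝓘(ℝ, ℝ) ∞ L) {w : Pontryagin E Q}
    {X : E × (E × (E →L[ℝ] ℝ))} (h : Solves (IW E) Omega (energyD L) w X) :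
    pr₂ w = legendre L (pr₁ w) := by
  refine (pr₂_eq_legendre_iff hL).2 (ContinuousLinearMap.ext fun u => ?_)
  have h1 := (solves_W_iff hL).1 h (0, (u, 0))
  simp only [map_zero, zero_apply, sub_zero, zero_add] at h1
  exact (sub_eq_zero.1 h1.symm)

/-- On the graph of the Legendre map, the solutions of the Skinner-Rusk equation tangent to the
graph are the second order solutions of the Lagrangian equation. -/
theorem solves_W_iff_solves_L (hL : ContMDiff (IT E) 𝓘(ℝ, ℝ) ∞ L) {w : Pontryagin E Q}
    {X : E × (E × (E →L[ℝ] ℝ))} (hw : pr₂ w = legendre L (pr₁ w))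
    (hX : mfderiv (IT E) (ITStar E) (legendre L) (pr₁ w) ((X.1, X.2.1) : E × E) =
      ((X.1, X.2.2) : E × (E →L[ℝ] ℝ))) :
    Solves (IW E) Omega (energyD L) w X ↔
      Solves (IT E) (OmegaL L) (energyL L) (pr₁ w) ((X.1, X.2.1) : E × E) ∧
        X.1 = velocity (pr₁ w) := by
  rw [mfderiv_legendre hL] at hX
  have hX2 : fderiv ℝ (localP L w.proj) (extChartAt (IT E) (pr₁ w) (pr₁ w)) (X.1, X.2.1) = X.2.2 :=
    (Prod.mk.inj hX).2
  rw [pr₂_eq_legendre_iff hL] at hw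
  rw [solves_W_iff hL, solves_L_iff hL]
  change _ ↔ (∀ Y : E × E, fderiv ℝ (localP L w.proj) _ Y X.1 -
        fderiv ℝ (localP L w.proj) _ (X.1, X.2.1) Y.1 = fderiv ℝ (localP L w.proj) _ Y _ +
        localP L w.proj _ Y.2 - fderiv ℝ (localL L w.proj) _ Y) ∧ _
  rw [hX2, hw]
  constructor
  · intro h
    have h1 : X.1 = velocity (pr₁ w) := by
      refine (SeparatingDual.eq_iff_forall_dual_eq (R := ℝ)).2 fun α => ?_
      -- Testing along the momenta isolates the second order condition.
      have h2 := h (0, (0, α))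
      have h3 : ((0 : E), (0 : E)) = 0 := rfl
      simpa [h3] using h2
    refine ⟨fun Y => ?_, h1⟩
    -- With the covector component zero, what remains is the Lagrangian equation once `X.1` is the
    -- velocity.
    have h2 := h (Y.1, (Y.2, 0))
    simp only [zero_apply, zero_sub, zero_add] at h2
    rw [h1]
    linarith
  · rintro ⟨h, h1⟩ Y
    have h2 := h (Y.1, Y.2.1)
    rw [h1] at h2 ⊢
    simp only at h2
    linarith

/-! ### The Legendre map in charts, as a submersion onto a linear subspace. -/

theorem hasMFDerivAt_extChartAt_symm_self {E H M : Type*} [NormedAddCommGroup E] [NormedSpace ℝ E]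
    [TopologicalSpace H] {I : ModelWithCorners ℝ E H} [I.Boundaryless] [TopologicalSpace M]
    [ChartedSpace H M] [IsManifold I ∞ M] (x : M) :
    HasMFDerivAt 𝓘(ℝ, E) I (extChartAt I x).symm (extChartAt I x x)
      (ContinuousLinearMap.id ℝ E) := by
  refine hasMFDerivAt_of_eventuallyEq_chart (continuousAt_extChartAt_symm x) (F := id) ?_
    (hasFDerivAt_id _)
  rw [extChartAt_to_inv]
  filter_upwards [extChartAt_target_mem_nhds (I := I) x] with y hy
  exact (extChartAt I x).right_inv hy

theorem fderiv_apply_of_hasMFDerivAt {F G : Type*} [NormedAddCommGroup F] [NormedSpace ℝ F]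
    [NormedAddCommGroup G] [NormedSpace ℝ G] {f : F → G} {A : F →L[ℝ] G} {x : F}
    (h : HasMFDerivAt 𝓘(ℝ, F) 𝓘(ℝ, G) f x A) (w : F) : fderiv ℝ f x w = A w := by
  have h1 : HasFDerivAt f A x := h.hasFDerivAt
  rw [h1.fderiv]

theorem mfderiv_apply_eq_zero {F G H H' M N : Type*} [NormedAddCommGroup F] [NormedSpace ℝ F]
    [NormedAddCommGroup G] [NormedSpace ℝ G] [TopologicalSpace H] [TopologicalSpace H']
    {I : ModelWithCorners ℝ F H} {J : ModelWithCorners ℝ G H'} [TopologicalSpace M]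
    [ChartedSpace H M] [TopologicalSpace N] [ChartedSpace H' N] {f : M → N} {x : M} {X : F}
    (h : X = 0) : (mfderiv I J f x X : G) = 0 := by
  subst h
  exact map_zero _

/-- The bundle chart at `v` is the identity on the fibre of `TQ` through `v`, so a curve in that
fibre is recovered from its second coordinate. -/
theorem mk_eq_of_proj_eq {v z : TQ E Q} (h : z.proj = v.proj) :
    (⟨v.proj, (extChartAt (IT E) v z).2⟩ : TQ E Q) = z := by
  obtain ⟨q, a⟩ := z
  obtain ⟨q', b⟩ := v
  subst h
  exact congrArg (TotalSpace.mk q) (congrArg Prod.snd (extChartAt_T_self (⟨q, a⟩ : TQ E Q)))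

/-- The Legendre map in the bundle chart at `v₀` of `TQ` and a chart `ψ` of `T^*Q`. -/
def legendreIn (L : TQ E Q → ℝ) (v₀ : TQ E Q)
    (ψ : OpenPartialHomeomorph (TStarQ E Q) (E × (E →L[ℝ] ℝ))) (x : E × E) : E × (E →L[ℝ] ℝ) :=
  ψ (legendre L ((extChartAt (IT E) v₀).symm x))

/-- The domain of `legendreIn`. -/
def legendreDom (L : TQ E Q → ℝ) (v₀ : TQ E Q)
    (ψ : OpenPartialHomeomorph (TStarQ E Q) (E × (E →L[ℝ] ℝ))) : Set (E × E) :=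
  (extChartAt (IT E) v₀).target ∩ (fun x => legendre L ((extChartAt (IT E) v₀).symm x)) ⁻¹' ψ.source

theorem isOpen_legendreDom (hL : ContMDiff (IT E) 𝓘(ℝ, ℝ) ∞ L) (v₀ : TQ E Q)
    (ψ : OpenPartialHomeomorph (TStarQ E Q) (E × (E →L[ℝ] ℝ))) : IsOpen (legendreDom L v₀ ψ) :=
  ((contMDiff_legendre hL).continuous.comp_continuousOn
    (continuousOn_extChartAt_symm v₀)).isOpen_inter_preimage (isOpen_extChartAt_target v₀)
      ψ.open_source

section

variable {v₀ : TQ E Q} {ψ : OpenPartialHomeomorph (TStarQ E Q) (E × (E →L[ℝ] ℝ))}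

theorem extChartAt_mem_legendreDom (h : legendre L v₀ ∈ ψ.source) :
    extChartAt (IT E) v₀ v₀ ∈ legendreDom L v₀ ψ := by
  refine ⟨mem_extChartAt_target v₀, ?_⟩
  rw [mem_preimage, extChartAt_to_inv]
  exact h

theorem contMDiffAt_extChartAt_symm_of_mem {x : E × E} (hx : x ∈ legendreDom L v₀ ψ) :
    ContMDiffAt 𝓘(ℝ, E × E) (IT E) ∞ (extChartAt (IT E) v₀).symm x :=
  (contMDiffOn_extChartAt_symm v₀).contMDiffAt ((isOpen_extChartAt_target v₀).mem_nhds hx.1)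

theorem contMDiffAt_of_contMDiffOn_source
    (hψ : ContMDiffOn (ITStar E) 𝓘(ℝ, E × (E →L[ℝ] ℝ)) ∞ ψ ψ.source) {a : TStarQ E Q}
    (ha : a ∈ ψ.source) : ContMDiffAt (ITStar E) 𝓘(ℝ, E × (E →L[ℝ] ℝ)) ∞ ψ a :=
  hψ.contMDiffAt (ψ.open_source.mem_nhds ha)

theorem contDiffOn_legendreIn (hL : ContMDiff (IT E) 𝓘(ℝ, ℝ) ∞ L)
    (hψ : ContMDiffOn (ITStar E) 𝓘(ℝ, E × (E →L[ℝ] ℝ)) ∞ ψ ψ.source) :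
    ContDiffOn ℝ ∞ (legendreIn L v₀ ψ) (legendreDom L v₀ ψ) := fun x hx =>
  ((contMDiffAt_of_contMDiffOn_source hψ hx.2).comp x ((contMDiff_legendre hL).contMDiffAt.comp x
    (contMDiffAt_extChartAt_symm_of_mem hx))).contDiffAt.contDiffWithinAt

theorem fderiv_legendreIn (hL : ContMDiff (IT E) 𝓘(ℝ, ℝ) ∞ L)
    (hψ : ContMDiffOn (ITStar E) 𝓘(ℝ, E × (E →L[ℝ] ℝ)) ∞ ψ ψ.source) {x : E × E}
    (hx : x ∈ legendreDom L v₀ ψ) (w : E × E) :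
    fderiv ℝ (legendreIn L v₀ ψ) x w =
      mfderiv (ITStar E) 𝓘(ℝ, E × (E →L[ℝ] ℝ)) ψ (legendre L ((extChartAt (IT E) v₀).symm x))
        (mfderiv (IT E) (ITStar E) (legendre L) ((extChartAt (IT E) v₀).symm x)
          (mfderiv 𝓘(ℝ, E × E) (IT E) (extChartAt (IT E) v₀).symm x w)) := by
  have h1 := ((contMDiffAt_extChartAt_symm_of_mem hx).mdifferentiableAt (by simp)).hasMFDerivAt
  have h2 := ((contMDiff_legendre hL).mdifferentiableAt
    (x := (extChartAt (IT E) v₀).symm x) (by simp)).hasMFDerivAt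
  have h3 := ((contMDiffAt_of_contMDiffOn_source hψ hx.2).mdifferentiableAt
    (by simp)).hasMFDerivAt
  exact fderiv_apply_of_hasMFDerivAt (h3.comp x (h2.comp x h1)) w

theorem mfderiv_chart_injective
    (hψ : ContMDiffOn (ITStar E) 𝓘(ℝ, E × (E →L[ℝ] ℝ)) ∞ ψ ψ.source)
    (hψ' : ContMDiffOn 𝓘(ℝ, E × (E →L[ℝ] ℝ)) (ITStar E) ∞ ψ.symm ψ.target) {a : TStarQ E Q}
    (ha : a ∈ ψ.source) (X : E × (E →L[ℝ] ℝ))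
    (h : mfderiv (ITStar E) 𝓘(ℝ, E × (E →L[ℝ] ℝ)) ψ a X = (0 : E × (E →L[ℝ] ℝ))) : X = 0 := by
  have h1 := ((contMDiffAt_of_contMDiffOn_source hψ ha).mdifferentiableAt (by simp)).hasMFDerivAt
  have h2 := ((hψ'.contMDiffAt (ψ.open_target.mem_nhds (ψ.map_source ha))).mdifferentiableAt
    (by simp)).hasMFDerivAt
  have h3 := h2.comp a h1
  have h4 : HasMFDerivAt (ITStar E) (ITStar E) (ψ.symm ∘ ψ) a (ContinuousLinearMap.id ℝ _) := by
    refine (hasMFDerivAt_id a).congr_of_eventuallyEq ?_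
    filter_upwards [ψ.open_source.mem_nhds ha] with b hb
    exact ψ.left_inv hb
  have h5 := congrArg (fun A : E × (E →L[ℝ] ℝ) →L[ℝ] E × (E →L[ℝ] ℝ) => A X)
    (hasMFDerivAt_unique h3 h4)
  exact h5.symm.trans (mfderiv_apply_eq_zero h)

theorem mfderiv_chart_symm
    (hψ : ContMDiffOn (ITStar E) 𝓘(ℝ, E × (E →L[ℝ] ℝ)) ∞ ψ ψ.source)
    (hψ' : ContMDiffOn 𝓘(ℝ, E × (E →L[ℝ] ℝ)) (ITStar E) ∞ ψ.symm ψ.target) {a : TStarQ E Q}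
    (ha : a ∈ ψ.source) (y : E × (E →L[ℝ] ℝ)) :
    mfderiv (ITStar E) 𝓘(ℝ, E × (E →L[ℝ] ℝ)) ψ a
      (mfderiv 𝓘(ℝ, E × (E →L[ℝ] ℝ)) (ITStar E) ψ.symm (ψ a) y) = y := by
  have h1 := ((contMDiffAt_of_contMDiffOn_source hψ ha).mdifferentiableAt (by simp)).hasMFDerivAt
  rw [← ψ.left_inv ha] at h1
  have h2 := ((hψ'.contMDiffAt (ψ.open_target.mem_nhds (ψ.map_source ha))).mdifferentiableAt
    (by simp)).hasMFDerivAt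
  have h3 := h1.comp (ψ a) h2
  have h4 : HasMFDerivAt 𝓘(ℝ, E × (E →L[ℝ] ℝ)) 𝓘(ℝ, E × (E →L[ℝ] ℝ)) (ψ ∘ ψ.symm) (ψ a)
      (ContinuousLinearMap.id ℝ _) := by
    refine (hasMFDerivAt_id (ψ a)).congr_of_eventuallyEq ?_
    filter_upwards [ψ.open_target.mem_nhds (ψ.map_source ha)] with b hb
    exact ψ.right_inv hb
  have h5 := congrArg (fun A : E × (E →L[ℝ] ℝ) →L[ℝ] E × (E →L[ℝ] ℝ) => A y)
    (hasMFDerivAt_unique h3 h4)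
  have h6 : ∀ b, b = a → mfderiv (ITStar E) 𝓘(ℝ, E × (E →L[ℝ] ℝ)) ψ b
      (mfderiv 𝓘(ℝ, E × (E →L[ℝ] ℝ)) (ITStar E) ψ.symm (ψ a) y) = y →
      mfderiv (ITStar E) 𝓘(ℝ, E × (E →L[ℝ] ℝ)) ψ a
      (mfderiv 𝓘(ℝ, E × (E →L[ℝ] ℝ)) (ITStar E) ψ.symm (ψ a) y) = y := by
    rintro b rfl h
    exact h
  exact h6 _ (ψ.left_inv ha) h5

/-- A segment of a line in `V` is carried by `ψ.symm` to a curve in the image of the Legendre map.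
Its velocity is thus tangent to the image, and the submersion hypothesis lifts it. -/
theorem fderiv_legendreIn_surj (hL : ContMDiff (IT E) 𝓘(ℝ, ℝ) ∞ L) (hreg : AlmostRegular L)
    (hψ : ContMDiffOn (ITStar E) 𝓘(ℝ, E × (E →L[ℝ] ℝ)) ∞ ψ ψ.source)
    (hψ' : ContMDiffOn 𝓘(ℝ, E × (E →L[ℝ] ℝ)) (ITStar E) ∞ ψ.symm ψ.target)
    (h0 : legendre L v₀ ∈ ψ.source) {V : Submodule ℝ (E × (E →L[ℝ] ℝ))}
    (hV : ψ '' (range (legendre L) ∩ ψ.source) = (V : Set _) ∩ ψ.target) :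
    ∀ y ∈ V, ∃ x, fderiv ℝ (legendreIn L v₀ ψ) (extChartAt (IT E) v₀ v₀) x = y := by
  intro y hy
  have hp : ψ (legendre L v₀) ∈ V := (hV.subset ⟨_, ⟨mem_range_self v₀, h0⟩, rfl⟩).1
  let c : ℝ → E × (E →L[ℝ] ℝ) := fun t => ψ (legendre L v₀) + t • y
  have hc : ContDiff ℝ ∞ c := by fun_prop
  have hc0 : c 0 = ψ (legendre L v₀) := by simp [c]
  have hcd : HasFDerivAt c (ContinuousLinearMap.toSpanSingleton ℝ y) 0 :=
    (ContinuousLinearMap.toSpanSingleton ℝ y).hasFDerivAt.const_add _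
  have hev : ∀ᶠ t in 𝓝 (0 : ℝ), c t ∈ ψ.target := hc.continuous.continuousAt.eventually (by
    rw [hc0]; exact ψ.open_target.mem_nhds (ψ.map_source h0))
  have hsd := ((hψ'.contMDiffAt (ψ.open_target.mem_nhds (ψ.map_source h0))).mdifferentiableAt
    (by simp : (∞ : ℕ∞ω) ≠ 0)).hasMFDerivAt
  have hY : (mfderiv 𝓘(ℝ, E × (E →L[ℝ] ℝ)) (ITStar E) ψ.symm (ψ (legendre L v₀)) y :
      E × (E →L[ℝ] ℝ)) ∈ tangentSet (ITStar E) (range (legendre L)) (legendre L v₀) := by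
    refine mem_tangentSet_iff.2 ⟨ψ.symm ∘ c, ?_, ?_, ?_⟩
    · filter_upwards [hev] with t ht
      refine ⟨(hψ'.contMDiffAt (ψ.open_target.mem_nhds ht)).comp t hc.contMDiff.contMDiffAt, ?_⟩
      obtain ⟨a, ha, hat⟩ := hV.superset ⟨V.add_mem hp (V.smul_mem t hy), ht⟩
      change ψ.symm (c t) ∈ _
      rw [show c t = ψ a from hat.symm, ψ.left_inv ha.2]
      exact ha.1
    · simp only [Function.comp, hc0, ψ.left_inv h0]
    · rw [← hc0] at hsd
      have h1 := hsd.comp 0 hcd.hasMFDerivAt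
      rw [h1.mfderiv, ← hc0]
      exact congrArg (mfderiv 𝓘(ℝ, E × (E →L[ℝ] ℝ)) (ITStar E) ψ.symm (c 0)) (one_smul ℝ y)
  obtain ⟨X, hX⟩ := hreg.submersion v₀ _ hY
  refine ⟨X, ?_⟩
  refine (fderiv_legendreIn hL hψ (extChartAt_mem_legendreDom h0) X).trans ?_
  rw [(hasMFDerivAt_extChartAt_symm_self v₀).mfderiv]
  have h2 : ∀ v, v = v₀ → mfderiv (ITStar E) 𝓘(ℝ, E × (E →L[ℝ] ℝ)) ψ (legendre L v)
    (mfderiv (IT E) (ITStar E) (legendre L) v X) = y := by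
    rintro v rfl
    rw [hX]
    exact mfderiv_chart_symm hψ hψ' h0 y
  exact h2 _ (extChartAt_to_inv v₀)

end

/-! ### Sections, fibre curves and constancy of the energy. -/

section Regular

variable [FiniteDimensional ℝ E]

/-- The Legendre map of an almost regular Lagrangian has smooth local sections over its image. -/
theorem exists_legendre_section (hL : ContMDiff (IT E) 𝓘(ℝ, ℝ) ∞ L) (hreg : AlmostRegular L)
    (v₀ : TQ E Q) :
    ∃ (s : TStarQ E Q → TQ E Q) (N : Set (TStarQ E Q)), IsOpen N ∧ legendre L v₀ ∈ N ∧
      ContMDiffOn (ITStar E) (IT E) ∞ s N ∧ s (legendre L v₀) = v₀ ∧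
      ∀ p ∈ N, p ∈ range (legendre L) → legendre L (s p) = p := by
  obtain ⟨ψ, V, h0, hψ, hψ', hV⟩ := hreg.submanifold _ (mem_range_self v₀)
  have hVU : ∀ x ∈ legendreDom L v₀ ψ, legendreIn L v₀ ψ x ∈ V := fun x hx =>
    (hV.subset ⟨_, ⟨mem_range_self _, hx.2⟩, rfl⟩).1
  have hbase : legendreIn L v₀ ψ (extChartAt (IT E) v₀ v₀) = ψ (legendre L v₀) := by
    unfold legendreIn
    rw [extChartAt_to_inv]
  obtain ⟨s, N, hN, h0N, hs, hs0, hsU, hsV⟩ := exists_local_section (isOpen_legendreDom hL v₀ ψ)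
    (extChartAt_mem_legendreDom h0) (contDiffOn_legendreIn hL hψ) hVU
    (fderiv_legendreIn_surj hL hreg hψ hψ' h0 hV)
  rw [hbase] at h0N hs0
  refine ⟨(extChartAt (IT E) v₀).symm ∘ s ∘ ψ, ψ.source ∩ ψ ⁻¹' N,
    ψ.isOpen_inter_preimage hN, ⟨h0, h0N⟩, ?_, ?_, ?_⟩
  · intro p hp
    refine ContMDiffAt.contMDiffWithinAt ?_
    have h1 := contMDiffAt_extChartAt_symm_of_mem (hsU _ hp.2)
    have h2 := (hs.contDiffAt (hN.mem_nhds hp.2)).contMDiffAt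
    exact h1.comp p (ContMDiffAt.comp p h2 (contMDiffAt_of_contMDiffOn_source hψ hp.1))
  · simp only [Function.comp, hs0, extChartAt_to_inv]
  · intro p hp hpr
    have h1 := hsV _ hp.2 (hV.subset ⟨_, ⟨hpr, hp.1⟩, rfl⟩).1
    exact ψ.injOn (hsU _ hp.2).2 hp.1 h1

/-- Vertical vectors in the kernel of the Legendre map are velocities of curves in its fibres. -/
theorem exists_legendre_fibre_curve (hL : ContMDiff (IT E) 𝓘(ℝ, ℝ) ∞ L) (hreg : AlmostRegular L)
    (v₀ : TQ E Q) {b : E} (hb : mfderiv (IT E) (ITStar E) (legendre L) v₀ ((0, b) : E × E) =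
      (0 : E × (E →L[ℝ] ℝ))) :
    ∃ c : ℝ → E, c 0 = velocity v₀ ∧ HasDerivAt c b 0 ∧
      ∀ᶠ t in 𝓝 (0 : ℝ), legendre L ⟨v₀.proj, c t⟩ = legendre L v₀ := by
  obtain ⟨ψ, V, h0, hψ, hψ', hV⟩ := hreg.submanifold _ (mem_range_self v₀)
  have hVU : ∀ x ∈ legendreDom L v₀ ψ, legendreIn L v₀ ψ x ∈ V := fun x hx =>
    (hV.subset ⟨_, ⟨mem_range_self _, hx.2⟩, rfl⟩).1
  have hbase : legendreIn L v₀ ψ (extChartAt (IT E) v₀ v₀) = ψ (legendre L v₀) := by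
    unfold legendreIn
    rw [extChartAt_to_inv]
  have hker : fderiv ℝ (legendreIn L v₀ ψ) (extChartAt (IT E) v₀ v₀) (0, b) = 0 := by
    rw [fderiv_legendreIn hL hψ (extChartAt_mem_legendreDom h0),
      (hasMFDerivAt_extChartAt_symm_self v₀).mfderiv]
    have h2 : ∀ v, v = v₀ → mfderiv (ITStar E) 𝓘(ℝ, E × (E →L[ℝ] ℝ)) ψ (legendre L v)
      (mfderiv (IT E) (ITStar E) (legendre L) v ((0, b) : E × E)) = (0 : E × (E →L[ℝ] ℝ)) := by
      rintro v rfl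
      exact mfderiv_apply_eq_zero hb
    exact h2 _ (extChartAt_to_inv v₀)
  obtain ⟨c, hc0, hcd, hcU⟩ := exists_fibre_curve (isOpen_legendreDom hL v₀ ψ)
    (extChartAt_mem_legendreDom h0) (contDiffOn_legendreIn hL hψ) hVU
    (fderiv_legendreIn_surj hL hreg hψ hψ' h0 hV) hker
  refine ⟨fun t => (c t).2, ?_, hcd.snd, ?_⟩
  · have h1 := congrArg Prod.snd (hc0.trans (extChartAt_T_self v₀))
    exact h1
  · filter_upwards [hcU] with t ht
    rw [hbase] at ht
    have h1 : legendre L ((extChartAt (IT E) v₀).symm (c t)) = legendre L v₀ :=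
      ψ.injOn ht.1.2 h0 ht.2
    have hp : (legendre L ((extChartAt (IT E) v₀).symm (c t))).proj = (legendre L v₀).proj :=
      congrArg TotalSpace.proj h1
    have h2 := mk_eq_of_proj_eq (v := v₀) (z := (extChartAt (IT E) v₀).symm (c t)) hp
    rw [(extChartAt (IT E) v₀).right_inv ht.1.1] at h2
    rw [h2, h1]

/-- dE_L vanishes on ker TFL, so the energy is locally constant along the fibres; connectedness
makes this global in `energyL_eq_of_legendre_eq`. -/
theorem eventually_energyL_eq (hL : ContMDiff (IT E) 𝓘(ℝ, ℝ) ∞ L) (hreg : AlmostRegular L)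
    (v₀ : TQ E Q) :
    ∀ᶠ v in 𝓝 v₀, legendre L v = legendre L v₀ → energyL L v = energyL L v₀ := by
  obtain ⟨ψ, V, h0, hψ, hψ', hV⟩ := hreg.submanifold _ (mem_range_self v₀)
  have hVU : ∀ x ∈ legendreDom L v₀ ψ, legendreIn L v₀ ψ x ∈ V := fun x hx =>
    (hV.subset ⟨_, ⟨mem_range_self _, hx.2⟩, rfl⟩).1
  have hd : ∀ x ∈ legendreDom L v₀ ψ,
      HasMFDerivAt 𝓘(ℝ, E × E) 𝓘(ℝ, ℝ) (energyL L ∘ (extChartAt (IT E) v₀).symm) x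
      ((mfderiv (IT E) 𝓘(ℝ, ℝ) (energyL L) ((extChartAt (IT E) v₀).symm x)).comp
        (mfderiv 𝓘(ℝ, E × E) (IT E) (extChartAt (IT E) v₀).symm x)) := fun x hx =>
    ((contMDiff_energyL hL).mdifferentiableAt (by simp)).hasMFDerivAt.comp x
      ((contMDiffAt_extChartAt_symm_of_mem hx).mdifferentiableAt (by simp)).hasMFDerivAt
  have h := eventually_eq_of_fderiv_eq_zero_on_ker (isOpen_legendreDom hL v₀ ψ)
    (extChartAt_mem_legendreDom h0) (contDiffOn_legendreIn hL hψ) hVU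
    (fderiv_legendreIn_surj hL hreg hψ hψ' h0 hV)
    (f := energyL L ∘ (extChartAt (IT E) v₀).symm)
    (fun x hx => (hd x hx).hasFDerivAt.differentiableAt.differentiableWithinAt) (by
      intro x hx w hw
      rw [fderiv_legendreIn hL hψ hx] at hw
      have h1 := mfderiv_chart_injective hψ hψ' hx.2 _ hw
      have h2 := dFun_energyL_of_mfderiv_legendre_eq_zero hL _ _ h1
      exact (fderiv_apply_of_hasMFDerivAt (hd x hx) w).trans h2)
  filter_upwards [(continuousAt_extChartAt (I := IT E) v₀).eventually h,
    extChartAt_source_mem_nhds (I := IT E) v₀] with v hv hvs hvL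
  have h1 := hv (by
    unfold legendreIn
    rw [extChartAt_to_inv, (extChartAt (IT E) v₀).left_inv hvs, hvL])
  simp only [Function.comp, extChartAt_to_inv, (extChartAt (IT E) v₀).left_inv hvs] at h1
  exact h1

/-- The energy is constant on the fibres of the Legendre map. -/
theorem energyL_eq_of_legendre_eq (hL : ContMDiff (IT E) 𝓘(ℝ, ℝ) ∞ L) (hreg : AlmostRegular L)
    {v v' : TQ E Q} (h : legendre L v = legendre L v') : energyL L v = energyL L v' := by
  have hF := (hreg.connected_fibres _ (mem_range_self v')).isPreconnected
  refine hF.induction₂ (fun x y => energyL L x = energyL L y) (fun x hx => ?_)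
    (fun x y z _ _ _ => Eq.trans) (fun x y _ _ => Eq.symm) h rfl
  filter_upwards [(eventually_energyL_eq hL hreg x).filter_mono nhdsWithin_le_nhds,
    self_mem_nhdsWithin] with y hy hy'
  exact (hy (Eq.trans hy' (Eq.symm hx))).symm

end Regular

/-! ### Projecting the Skinner-Rusk algorithm to `TQ`. -/

theorem W_one_subset_graph (hL : ContMDiff (IT E) 𝓘(ℝ, ℝ) ∞ L) {w : Pontryagin E Q}
    (hw : w ∈ W L 1) : pr₂ w = legendre L (pr₁ w) := by
  obtain ⟨-, X, -, hX⟩ := hw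
  exact pr₂_eq_legendre_of_solves hL hX

/-- A solution of the Skinner-Rusk equation tangent to `W₁` projects to a second order solution of
the Lagrangian equation. -/
theorem solves_L_of_solves_W (hL : ContMDiff (IT E) 𝓘(ℝ, ℝ) ∞ L) {w : Pontryagin E Q}
    {X : TangentSpace (IW E) w} (hX : X ∈ tangentSet (IW E) (W L 1) w)
    (h : Solves (IW E) Omega (energyD L) w X) :
    Solves (IT E) (OmegaL L) (energyL L) (pr₁ w) (mfderiv (IW E) (IT E) pr₁ w X) ∧
      vertS (pr₁ w) (mfderiv (IW E) (IT E) pr₁ w X) = liouville (pr₁ w) := by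
  have h1 := mfderiv_eq_of_eqOn hX
    ((contMDiff_legendre hL).comp contMDiff_pr₁ |>.mdifferentiableAt (by simp))
    (contMDiff_pr₂.mdifferentiableAt (by simp))
    (Filter.Eventually.of_forall fun z hz => (W_one_subset_graph hL hz).symm)
  rw [mfderiv_comp w ((contMDiff_legendre hL).mdifferentiableAt (by simp))
    (contMDiff_pr₁.mdifferentiableAt (by simp))] at h1
  let Y : E × (E × (E →L[ℝ] ℝ)) := X
  have h2 : mfderiv (IW E) (IT E) pr₁ w X = ((Y.1, Y.2.1) : E × E) := mfderiv_pr₁ w Y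
  have h3 : mfderiv (IW E) (ITStar E) pr₂ w X = ((Y.1, Y.2.2) : E × (E →L[ℝ] ℝ)) :=
    mfderiv_pr₂ w Y
  have h4 : mfderiv (IT E) (ITStar E) (legendre L) (pr₁ w) (mfderiv (IW E) (IT E) pr₁ w X) =
    ((Y.1, Y.2.2) : E × (E →L[ℝ] ℝ)) := h1.trans h3
  rw [h2] at h4
  obtain ⟨h5, h6⟩ := (solves_W_iff_solves_L hL (X := Y) (pr₂_eq_legendre_of_solves hL h) h4).1 h
  rw [h2]
  exact ⟨h5, (vertS_eq_liouville_iff (pr₁ w) (Y.1, Y.2.1)).2 h6⟩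

theorem pr₁_image_W_subset (hL : ContMDiff (IT E) 𝓘(ℝ, ℝ) ∞ L) (k : ℕ) :
    pr₁ '' W L (k + 1) ⊆ P L (k + 1) := by
  induction k with
  | zero => exact subset_univ _
  | succ k ih =>
    rintro _ ⟨w, ⟨hw, X, hX, hs⟩, rfl⟩
    refine ⟨ih ⟨w, hw, rfl⟩, mfderiv (IW E) (IT E) pr₁ w X, ?_, ?_⟩
    · exact mfderiv_mem_tangentSet hX (Filter.Eventually.of_forall fun z => contMDiff_pr₁ z)
        (Filter.Eventually.of_forall fun z hz => ih ⟨z, hz, rfl⟩)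
    -- Tangency to `W L (k + 1)` implies tangency to `W L 1`, hence to the graph.
    · exact (solves_L_of_solves_W hL
        (tangentSet_mono (constraintSet_antitone (Nat.le_add_left 1 k)) w hX) hs).1

/-- The lift of `TQ` to the graph of the Legendre map. -/
def graphMap (L : TQ E Q → ℝ) (v : TQ E Q) : Pontryagin E Q :=
  ⟨v.proj, (v.snd, (legendre L v).snd)⟩

theorem contMDiff_graphMap (hL : ContMDiff (IT E) 𝓘(ℝ, ℝ) ∞ L) :
    ContMDiff (IT E) (IW E) ∞ (graphMap L) := fun _ =>
  contMDiffAt_whitney contMDiffAt_id (contMDiff_legendre hL).contMDiffAt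

/-! ### Invariance along Legendre fibres and lifting to the sets `W_k`. -/

section Regular

variable [FiniteDimensional ℝ E]

/-- Points of the same fibre of the Legendre map are exchanged by local maps that preserve its
fibres. -/
theorem exists_fibre_transport (hL : ContMDiff (IT E) 𝓘(ℝ, ℝ) ∞ L) (hreg : AlmostRegular L)
    {v v' : TQ E Q} (hv : legendre L v = legendre L v') :
    ∃ r : TQ E Q → TQ E Q, (∀ᶠ z in 𝓝 v, ContMDiffAt (IT E) (IT E) ∞ r z) ∧ r v = v' ∧
      ∀ᶠ z in 𝓝 v, legendre L (r z) = legendre L z := by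
  obtain ⟨s, N, hN, h0, hs, hs0, hsN⟩ := exists_legendre_section hL hreg v'
  have hFL := contMDiff_legendre hL
  have hev : ∀ᶠ z in 𝓝 v, legendre L z ∈ N :=
    hFL.continuous.continuousAt.eventually (hN.mem_nhds (hv ▸ h0))
  refine ⟨s ∘ legendre L, ?_, by simp only [Function.comp, hv, hs0], ?_⟩
  · filter_upwards [hev] with z hz
    exact (hs.contMDiffAt (hN.mem_nhds hz)).comp z hFL.contMDiffAt
  · filter_upwards [hev] with z hz
    exact hsN _ hz (mem_range_self z)

/-- The Lagrangian equation depends only on the image under the Legendre map. -/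
theorem solves_of_mfderiv_legendre_eq (hL : ContMDiff (IT E) 𝓘(ℝ, ℝ) ∞ L)
    (hreg : AlmostRegular L)
    {v v' : TQ E Q} (hv : legendre L v = legendre L v') {X : TangentSpace (IT E) v}
    {X' : TangentSpace (IT E) v'}
    (hX : (mfderiv (IT E) (ITStar E) (legendre L) v X : E × (E →L[ℝ] ℝ)) =
      mfderiv (IT E) (ITStar E) (legendre L) v' X')
    (h : Solves (IT E) (OmegaL L) (energyL L) v X) :
    Solves (IT E) (OmegaL L) (energyL L) v' X' := by
  intro Y'
  -- Here `r` goes backwards, from `v'` to `v`, because it is the test vector `Y'` that is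
  -- transported. It preserves both the Legendre map and the energy, so the two sides of the
  -- equation are unchanged.
  obtain ⟨r, hr, hr0, hrL⟩ := exists_fibre_transport hL hreg hv.symm
  have hrd := hr.self_of_nhds.mdifferentiableAt (by simp : (∞ : ℕ∞ω) ≠ 0)
  have h1 := mfderiv_apply_of_comp_eventuallyEq hrd hr0
    ((contMDiff_legendre hL).mdifferentiableAt (by simp)) hrL Y'
  have h2 := mfderiv_apply_of_comp_eventuallyEq hrd hr0
    ((contMDiff_energyL hL).mdifferentiableAt (by simp))
    (hrL.mono fun z hz => energyL_eq_of_legendre_eq hL hreg hz) Y'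
  have h3 := h (mfderiv (IT E) (IT E) r v' Y' : E × E)
  rw [OmegaL_eq_legendre hL v X _ hX h1] at h3
  rw [OmegaL_eq_legendre hL v' X' Y' rfl rfl, h3]
  exact h2

/-- A fibre-preserving local map `r` from `v` to `v'` preserves the `k`-th set by induction, so it
sends tangent vectors to tangent vectors. Since it does not change their images under TFL, it sends
solutions to solutions. -/
theorem constraintSet_saturated (hL : ContMDiff (IT E) 𝓘(ℝ, ℝ) ∞ L) (hreg : AlmostRegular L)
    (k : ℕ) {v v' : TQ E Q} (hv : legendre L v = legendre L v')
    (h : v ∈ constraintSet (IT E) (OmegaL L) (energyL L) k) :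
    v' ∈ constraintSet (IT E) (OmegaL L) (energyL L) k := by
  induction k generalizing v v' with
  | zero => trivial
  | succ k ih =>
    obtain ⟨hk, X, hX, hs⟩ := h
    obtain ⟨r, hr, hr0, hrL⟩ := exists_fibre_transport hL hreg hv
    subst hr0
    refine ⟨ih hv hk, mfderiv (IT E) (IT E) r v X, mfderiv_mem_tangentSet hX hr
      (hrL.mono fun z hz hzk => ih hz.symm hzk), solves_of_mfderiv_legendre_eq hL hreg hv ?_ hs⟩
    exact (mfderiv_apply_of_comp_eventuallyEq (hr.self_of_nhds.mdifferentiableAt (by simp)) rfl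
      ((contMDiff_legendre hL).mdifferentiableAt (by simp)) hrL X).symm

/-- The base component of a solution of the Lagrangian equation lies in the same fibre of the
Legendre map. -/
theorem legendre_mk_eq_of_solves (hL : ContMDiff (IT E) 𝓘(ℝ, ℝ) ∞ L) (hreg : AlmostRegular L)
    (v : TQ E Q) (X : E × E) (h : Solves (IT E) (OmegaL L) (energyL L) v X) :
    legendre L ⟨v.proj, X.1⟩ = legendre L v := by
  -- A Euclidean norm makes the squared distance differentiable, whatever the norm of `E`.
  let T : E ≃L[ℝ] EuclideanSpace ℝ (Fin (Module.finrank ℝ E)) := toEuclidean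
  let D : E → E →L[ℝ] ℝ := fderiv ℝ (fun u : E => L ⟨v.proj, u⟩)
  have hD : Continuous D :=
    (hL.comp (contMDiff_fibre v.proj)).contDiff.continuous_fderiv (by simp)
  let F : Set (EuclideanSpace ℝ (Fin (Module.finrank ℝ E))) :=
    {y | D (T.symm y) = D (velocity v)}
  have hF : IsClosed F := isClosed_eq (hD.comp T.symm.continuous) continuous_const
  have hFne : F.Nonempty := ⟨T (velocity v), by
    change D (T.symm (T (velocity v))) = _
    rw [T.symm_apply_apply]⟩
  -- The nearest point of the closed fibre to `X.1`; it turns out to be `X.1` itself.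
  obtain ⟨y, hyF, hy⟩ := hF.exists_infDist_eq_dist hFne (T X.1)
  have hFiff : ∀ a : E, T a ∈ F ↔ legendre L ⟨v.proj, a⟩ = legendre L v := by
    intro a
    change D (T.symm (T a)) = _ ↔ _
    rw [T.symm_apply_apply]
    exact ⟨fun h => congrArg (TotalSpace.mk v.proj) h, fun h => eq_of_heq (TotalSpace.mk.inj h).2⟩
  obtain ⟨a, rfl⟩ := T.surjective y
  have ha := (hFiff a).1 hyF
  suffices h0 : a = X.1 by rwa [h0] at ha
  obtain ⟨r, hr, hr0, hrL⟩ := exists_fibre_transport hL hreg ha.symm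
  let X' : E × E := mfderiv (IT E) (IT E) r v X
  have hFX := mfderiv_apply_of_comp_eventuallyEq (hr.self_of_nhds.mdifferentiableAt (by simp)) hr0
      ((contMDiff_legendre hL).mdifferentiableAt (by simp)) hrL X
  have hs' : Solves (IT E) (OmegaL L) (energyL L) ⟨v.proj, a⟩ X' :=
    solves_of_mfderiv_legendre_eq hL hreg ha.symm hFX.symm h
  -- The Legendre map covers the identity of `Q`, so TFL determines the base component.
  have hX1 : X'.1 = X.1 := by
    have h1 := mfderiv_legendre hL ⟨v.proj, a⟩ X'
    have h2 := mfderiv_legendre hL v X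
    exact (Prod.mk.inj ((h1.symm.trans hFX).trans h2)).1
  have hdev := mfderiv_legendre_deviation hL ⟨v.proj, a⟩ X' hs'
  obtain ⟨c, hc0, hcd, hcF⟩ := exists_legendre_fibre_curve hL hreg ⟨v.proj, a⟩ hdev
  have hc0' : c 0 = a := hc0
  have hcd' : HasDerivAt c (X.1 - a) 0 := by
    rw [← hX1]
    exact hcd
  have hg := (((T : E →L[ℝ] _).hasFDerivAt.comp_hasDerivAt 0 hcd').sub_const (T X.1)).norm_sq
  have hmin : IsLocalMin (fun t => ‖((T : E →L[ℝ] _) ∘ c) t - T X.1‖ ^ 2) 0 := by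
    filter_upwards [hcF] with t ht
    have h1 : T (c t) ∈ F := (hFiff (c t)).2 (ht.trans ha)
    have h2 := Metric.infDist_le_dist_of_mem (x := T X.1) h1
    rw [hy, dist_comm, dist_eq_norm, dist_comm, dist_eq_norm] at h2
    change ‖T (c 0) - T X.1‖ ^ 2 ≤ ‖T (c t) - T X.1‖ ^ 2
    rw [hc0']
    gcongr
  -- The vanishing derivative is -2‖T(a - X_q)‖², as the fibre curve starts at `a` with velocity X_q
  -- - a.
  have h0 := hmin.hasDerivAt_eq_zero hg
  have h1 : ((T : E →L[ℝ] _) ∘ c) 0 - T X.1 = T (a - X.1) := by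
    simp only [Function.comp, hc0']
    exact (map_sub T _ _).symm
  have h2 : (T : E →L[ℝ] EuclideanSpace ℝ (Fin (Module.finrank ℝ E))) (X.1 - a) =
      - T (a - X.1) := by
    rw [← map_neg, neg_sub]
    rfl
  rw [h1, h2, inner_neg_right, real_inner_self_eq_norm_sq] at h0
  have h3 : ‖T (a - X.1)‖ = 0 := by
    have : ‖T (a - X.1)‖ ^ 2 = 0 := by linarith
    exact pow_eq_zero_iff (by norm_num) |>.1 this
  exact sub_eq_zero.1 ((map_eq_zero_iff T T.injective).1 (norm_eq_zero.1 h3))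

/-- Over a set saturated by the fibres of the Legendre map that carries a solution field, there are
points in all the constraint sets `W_k`. -/
theorem exists_mem_W_of_solutionField (hL : ContMDiff (IT E) 𝓘(ℝ, ℝ) ∞ L) (hreg : AlmostRegular L)
    {S : Set (TQ E Q)} (hS : ∀ v v', legendre L v = legendre L v' → v ∈ S → v' ∈ S)
    (hξ : HasSolutionField L S) {v₀ : TQ E Q} (hv₀ : v₀ ∈ S) (k : ℕ) :
    ∃ w ∈ W L k, w.proj = v₀.proj := by
  obtain ⟨ξ, hξs, hξt⟩ := hξ
  obtain ⟨s, N, hN, h0, hs, hs0, hsN⟩ := exists_legendre_section hL hreg v₀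
  have hFL := contMDiff_legendre hL
  -- The section `s` is replaced by the base velocity of `ξ` along it, which stays in the same
  -- Legendre fibres and will make the lifted vectors second order.
  let σ : TStarQ E Q → TQ E Q := fun p => tangentMap (IT E) 𝓘(ℝ, E) tau ⟨s p, ξ (s p)⟩
  have hσ : ∀ p, σ p = ⟨(s p).proj, (show E × E from ξ (s p)).1⟩ := fun p =>
    congrArg (TotalSpace.mk (s p).proj) (mfderiv_tau (s p) (ξ (s p)))
  have hsp : ∀ p ∈ N, p ∈ legendre L '' S → legendre L (s p) = p ∧ s p ∈ S := by
    rintro p hp ⟨v, hv, rfl⟩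
    have h1 := hsN _ hp (mem_range_self v)
    exact ⟨h1, hS _ _ h1.symm hv⟩
  have hFσ : ∀ p ∈ N, p ∈ legendre L '' S → legendre L (σ p) = p := by
    intro p hp hpS
    obtain ⟨h1, h2⟩ := hsp p hp hpS
    rw [hσ]
    exact (legendre_mk_eq_of_solves hL hreg (s p) (ξ (s p)) (hξt _ h2).2).trans h1
  -- The induction runs over all `p` near the given point, since tangency to `W L k` needs a whole
  -- curve of such points.
  have key : ∀ k : ℕ, ∀ p ∈ N, p ∈ legendre L '' S → graphMap L (σ p) ∈ W L k := by
    intro k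
    induction k with
    | zero => exact fun _ _ _ => trivial
    | succ k ih =>
      intro p hp hpS
      refine ⟨ih p hp hpS, ?_⟩
      obtain ⟨h1, h2⟩ := hsp p hp hpS
      obtain ⟨ht, hsol⟩ := hξt _ h2
      obtain ⟨c, hc, hc0, hc1⟩ := mem_tangentSet_iff.1 ht
      have hγ0 : (legendre L ∘ c) 0 = p := by simp only [Function.comp, hc0, h1]
      have hγs : ∀ᶠ t in 𝓝 (0 : ℝ), ContMDiffAt 𝓘(ℝ, ℝ) (ITStar E) ∞ (legendre L ∘ c) t ∧
          (legendre L ∘ c) t ∈ legendre L '' S := by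
        filter_upwards [hc] with t ht
        exact ⟨hFL.contMDiffAt.comp t ht.1, _, ht.2, rfl⟩
      have hγN : ∀ᶠ t in 𝓝 (0 : ℝ), (legendre L ∘ c) t ∈ N :=
        hγs.self_of_nhds.1.continuousAt.eventually (by rw [hγ0]; exact hN.mem_nhds hp)
      have hσs : ∀ᶠ t in 𝓝 (0 : ℝ), ContMDiffAt 𝓘(ℝ, ℝ) (IT E) ∞ (σ ∘ legendre L ∘ c) t := by
        filter_upwards [(hγs.and hγN).eventually_nhds] with t ht
        have h3 := ht.self_of_nhds
        have h4 : ContMDiffAt 𝓘(ℝ, ℝ) (IT E) ∞ (s ∘ legendre L ∘ c) t :=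
          (hs.contMDiffAt (hN.mem_nhds h3.2)).comp t h3.1.1
        -- The field is smooth only within `S`; the curve `s ∘ legendre L ∘ c` stays in `S` near
        -- `t`, so the composite is smooth in the full sense.
        have h5 : (s ∘ legendre L ∘ c) ⁻¹' S ∈ 𝓝 t := by
          filter_upwards [ht] with t' ht'
          exact (hsp _ ht'.2 ht'.1.2).2
        have h6 := ((hξs _ (hsp _ h3.2 h3.1.2).2).comp t (h4.contMDiffWithinAt
          (s := (s ∘ legendre L ∘ c) ⁻¹' S)) (fun t' ht' => ht')).contMDiffAt h5
        exact (contMDiff_tau.contMDiff_tangentMap (m := ∞) le_rfl).contMDiffAt.comp t h6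
      have hws : ∀ᶠ t in 𝓝 (0 : ℝ), ContMDiffAt 𝓘(ℝ, ℝ) (IW E) ∞
          (graphMap L ∘ σ ∘ legendre L ∘ c) t := by
        filter_upwards [hσs] with t ht
        exact (contMDiff_graphMap hL).contMDiffAt.comp t ht
      have hσ0 : (σ ∘ legendre L ∘ c) 0 = σ p := congrArg σ hγ0
      have hw0 : (graphMap L ∘ σ ∘ legendre L ∘ c) 0 = graphMap L (σ p) :=
        congrArg (graphMap L) hσ0
      let X : E × (E × (E →L[ℝ] ℝ)) :=
        mfderiv 𝓘(ℝ, ℝ) (IW E) (graphMap L ∘ σ ∘ legendre L ∘ c) 0 (1 : ℝ)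
      refine ⟨X, mem_tangentSet_iff.2 ⟨_, ?_, hw0, rfl⟩, ?_⟩
      · filter_upwards [hws, hγs, hγN] with t h3 h4 h5
        exact ⟨h3, ih _ h5 h4.2⟩
      have hwd := hws.self_of_nhds.mdifferentiableAt (by simp : (∞ : ℕ∞ω) ≠ 0)
      have hσd := hσs.self_of_nhds.mdifferentiableAt (by simp : (∞ : ℕ∞ω) ≠ 0)
      have hcd := hc.self_of_nhds.1.mdifferentiableAt (by simp : (∞ : ℕ∞ω) ≠ 0)
      have hv1 := mfderiv_comp_curve (f := pr₁) (X := X) hwd hw0 rfl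
        (contMDiff_pr₁.mdifferentiableAt (by simp))
      have hv2 := mfderiv_comp_curve (f := pr₂) (X := X) hwd hw0 rfl
        (contMDiff_pr₂.mdifferentiableAt (by simp))
      rw [mfderiv_pr₁] at hv1
      rw [mfderiv_pr₂] at hv2
      have hv3 := mfderiv_comp_curve (f := legendre L) (X := ((X.1, X.2.1) : E × E)) hσd hσ0 hv1
        (hFL.mdifferentiableAt (by simp))
      have hv4 : mfderiv (IT E) (ITStar E) (legendre L) (σ p) ((X.1, X.2.1) : E × E) =
        ((X.1, X.2.2) : E × (E →L[ℝ] ℝ)) := hv3.symm.trans hv2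
      have hv5 := mfderiv_comp_curve (f := legendre L) hcd hc0 hc1
        (hFL.mdifferentiableAt (by simp))
      have hev : legendre L ∘ σ ∘ legendre L ∘ c =ᶠ[𝓝 0] legendre L ∘ c := by
        filter_upwards [hγs, hγN] with t h3 h4
        exact hFσ _ h4 h3.2
      have hv6 : (mfderiv (IT E) (ITStar E) (legendre L) (s p) (ξ (s p)) : E × (E →L[ℝ] ℝ)) =
          mfderiv (IT E) (ITStar E) (legendre L) (σ p) ((X.1, X.2.1) : E × E) := by
        refine hv5.symm.trans (Eq.trans ?_ hv3)
        exact congrArg (fun A : ℝ →L[ℝ] E × (E →L[ℝ] ℝ) => A 1) hev.mfderiv_eq.symm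
      -- The projected velocity at `σ p` and `ξ (s p)` have the same image under TFL, so the
      -- equation transfers. Their base components agree too, and that of `ξ (s p)` is the velocity
      -- of `σ p` by construction.
      refine (solves_W_iff_solves_L hL (w := graphMap L (σ p)) rfl hv4).2 ⟨?_, ?_⟩
      · exact solves_of_mfderiv_legendre_eq hL hreg (h1.trans (hFσ p hp hpS).symm) hv6 hsol
      · have h3 := mfderiv_legendre hL (s p) (ξ (s p))
        have h4 := mfderiv_legendre hL (σ p) (X.1, X.2.1)
        have h5 := congrArg Prod.fst ((h3.symm.trans hv6).trans h4)
        refine h5.symm.trans ?_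
        change _ = velocity (σ p)
        rw [hσ]
        rfl
  refine ⟨_, key k _ h0 ⟨v₀, hv₀, rfl⟩, ?_⟩
  change (s (legendre L v₀)).proj = v₀.proj
  rw [hs0]

end Regular

end SkinnerRusk

end

/-! ### The theorem. -/

theorem mainTheorem6
    {E : Type*} [NormedAddCommGroup E] [NormedSpace ℝ E] [FiniteDimensional ℝ E]
    {Q : Type*} [TopologicalSpace Q] [ChartedSpace E Q] [IsManifold 𝓘(ℝ, E) ∞ Q]
    [T2Space Q] [SecondCountableTopology Q]
    (L : TQ E Q → ℝ)
    (hL : ContMDiff (IT E) 𝓘(ℝ, ℝ) ∞ L)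
    (hreg : AlmostRegular L)
    (hW : ∀ k : ℕ, IsEmbeddedSubmanifold (IW E) (W L k))
    (hP : ∀ k : ℕ, 1 ≤ k →
      IsEmbeddedSubmanifold (IT E) (P L k)) :
    (∀ w ∈ W L 1,
      ∀ X ∈ tangentSet (IW E) (W L 1) w,
      Solves (IW E) Omega (energyD L) w X →
        Solves (IT E) (OmegaL L) (energyL L)
          (pr₁ w)
          (mfderiv (IW E) (IT E) pr₁ w X) ∧
        vertS (pr₁ w)
          (mfderiv (IW E) (IT E) pr₁ w X) =
            liouville (pr₁ w)) ∧
    (∀ k : ℕ, 1 ≤ k → pr₁ '' W L k ⊆ P L k) ∧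
    (∀ k l : ℕ, W L k = W L (k + 1) →
      1 ≤ l → P L l = P L (l + 1) →
      HasSolutionField L (P L l) →
      pr '' W L k = tau '' P L l) := by
  refine ⟨fun w _ X hX h => solves_L_of_solves_W hL hX h, fun k hk => ?_, ?_⟩
  · obtain ⟨m, rfl⟩ := Nat.exists_eq_add_of_le' hk
    exact pr₁_image_W_subset hL m
  · intro k l hk hl hlP hξ
    obtain ⟨m, rfl⟩ := Nat.exists_eq_add_of_le' hl
    refine Subset.antisymm ?_ ?_
    · rintro _ ⟨w, hw, rfl⟩
      -- An index past the stabilization of the `W_k` and at least `l = m + 1`: then (ii) applies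
      -- and lands inside `P L l`, even if `k` is `0` or less than `l`.
      have h1 : w ∈ W L (max k m + 1) :=
        (constraintSet_eq_of_stable hk ((le_max_left k m).trans (Nat.le_succ _))).superset hw
      have h2 : pr₁ w ∈ P L (max k m + 1) := pr₁_image_W_subset hL _ ⟨w, h1, rfl⟩
      exact ⟨pr₁ w, constraintSet_antitone (le_max_right k m) h2, rfl⟩
    · rintro _ ⟨v, hv, rfl⟩
      exact exists_mem_W_of_solutionField hL hreg
        (fun _ _ h => constraintSet_saturated hL hreg m h) hξ hv k
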